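/- **Setting.** *Pool.* A liquidity pool has a set $\Sigma$ of states with an initial state $s_0$, a set $A$ of atomic actions with a null action $\bot\in A$, and the set $A^*$ of nonempty words over $A$ (the actions, or trades). For each state $s$ there is a set $A_s\subseteq A^*$ of admissible actions; there are a transition map $\tau:\Sigma\times A^*\to\Sigma$ and a payoff map $\pi:A^*\to\mathbb R^2$. One has $\bot\in A_s$, $\tau(s,\bot)=s$, $\pi(\bot)=0$; $\pi(ab)=\pi(a)+\pi(b)$, $\tau(s,ab)=\tau(\tau(s,a),b)$, and $a\in A_s$, $b\in A_{\tau(s,a)}$ imply $ab\in A_s$. For every state $s$ and price $P>0$ there is an atomic action $a^*(s,P)\in A_s\cap A$ maximizing $\Delta x\,P+\Delta y$, $(\Delta x,\Delta y)=\pi(a)$, over $a\in A_s$. A no-arbitrage state for $P$ is a state $s$ with $\Delta x\,P+\Delta y\le 0$ for all $a\in A_s$. The pool is *frictionless* if for every $P>0$ there is exactly one no-arbitrage state. A trade is *non-null* if it contains a letter different from $\bot$. *Market.* On a filtered probability space let $P_t>0$ ($t\ge0$) be a semimartingale (the external price), and let $0<t_1<t_2<\cdots\to\infty$ be deterministic block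 times. For each block $n$ and each finite sequence $T$ of trades, the ordering mechanism gives a random permutation of $T$ with a prescribed law. The trades submitted for block $n$ are put in this random order; going through them, each trade that is not admissible in the current pool state is dropped, and the others are executed. The resulting state is the initial state of the next block. *Strategies.* A trading strategy consists of a predictable process $x_t$ and an adapted process $y_t$ (its holdings of the risky asset and of the numéraire), with $\mathbb E\int_0^t x_s^2P_s^2\,ds<\infty$ for all $t$, and, for each block $n$, a sequence of submitted trades whose payoffs are known at time $t_n$. It is self-financing: for every $t$, almost surely $$\mathsf{PNL}(S)_t:=x_tP_t+y_t-(x_0P_0+y_0)=\int_0^tx_s\,dP_s+\sum_{i:\,t_i\le t}\ \sum_j(\Delta x_{i,j}P_{t_i}+\Delta y_{i,j}),$$ where $(\Delta x_{i,j},\Delta y_{i,j})_j$ are the payoffs of its trades executed for block $i$. A finite set of $k$ strategies is *competitive* if their executed trades are disjoint and all on-chain trades are submitted by them; their holdings of the risky asset sum to $0$ at all times; almost surely, after each block $n$ the pool is in a no-arbitrage state for $P_{t_n}$; and either $k=1$, or almost surely each of the strategies submits, for at least one block, a non-null trade that is admissible in the pool state at the beginning of the block, and for infinitely many blocks at least two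 of them do so. For $m\ge1$ and $t\ge0$, let $\mathcal S$ range over all competitive sets of $m$ or more strategies and put $$\mathsf{MEV}_m(B)_t=\sup_{\mathcal S}\ \mathbb E\Big[\sum_{S\in\mathcal S}\mathsf{PNL}(S)_t\Big],\qquad \mathsf{MEV}^{\mathrm{path}}_m(B)_t=\operatorname*{ess\,sup}_{\mathcal S}\ \sum_{S\in\mathcal S}\mathsf{PNL}(S)_t ,$$ where expectations $\mathbb E[X]=\mathbb E[X^+]-\mathbb E[X^-]$ take values in $[-\infty,\infty]$ (and are $-\infty$ if both terms are infinite). The *simple arbitrage strategy* $S_0$ has $x_t=0$ and submits, for each block $n$, the single trade $a^*(s_n,P_{t_n})$, where $s_n$ is the pool state at the beginning of block $n$; $\mathsf{PNL}^*(S_0)$ is its PNL if no one else submits on-chain trades. **Corollary (Competitive MEV is average competitive pathwise MEV).** Let $B$ be a blockchain market with deterministic block times whose pool is frictionless, and let $t\ge0$. Then, for $m=1$, and for all $m\ge 2$ if at least one non-null trade is admissible in some no-arbitrage state of the pool, $\mathsf{MEV}_m(B)_t$ and, up to almost sure equality, $\mathsf{MEV}^{\mathrm{path}}_m(B)_t$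 do not depend on $m$; and their common values $\mathsf{MEV}(B)_t$ and $\mathsf{MEV}^{\mathrm{path}}(B)_t$ satisfy $$\mathsf{MEV}(B)_t=\mathbb E\big[\mathsf{PNL}^*(S_0)_t\big]=\mathbb E\big[\mathsf{MEV}^{\mathrm{path}}(B)_t\big].$$ -/

import Mathlib

open MeasureTheory ProbabilityTheory Filter Topology
open scoped NNReal ENNReal

noncomputable section

namespace CompetitiveMEV

/-! ## Liquidity pools -/

/-- The value `Δx * P + Δy` of a payoff `(Δx, Δy)` at the external price `P`. -/
def value (P : ℝ) (v : ℝ × ℝ) : ℝ := v.1 * P + v.2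

/-- A liquidity pool with state space `S` and atomic action space `A`, together with the liquidity
pool axioms. The actions (trades) `A*` are the nonempty words in the atomic actions, that is, the
free semigroup on `A`. External prices are positive real numbers. -/
structure LiquidityPool (S A : Type*) where
  /-- the actions that are admissible in a given state -/
  admissible : S → Set (FreeSemigroup A)
  transition : S → FreeSemigroup A → S
  payoff : FreeSemigroup A → ℝ × ℝ
  initialState : S
  null : A
  null_admissible : ∀ s, FreeSemigroup.of null ∈ admissible s
  transition_null : ∀ s, transition s (FreeSemigroup.of null) = s
  payoff_null : payoff (FreeSemigroup.of null) = 0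
  payoff_mul : ∀ a b, payoff (a * b) = payoff a + payoff b
  transition_mul : ∀ s a b, transition s (a * b) = transition (transition s a) b
  admissible_mul : ∀ s a b, a ∈ admissible s → b ∈ admissible (transition s a) →
    a * b ∈ admissible s
  exists_optimal : ∀ s (P : ℝ), 0 < P → ∃ a : A, FreeSemigroup.of a ∈ admissible s ∧
    ∀ b ∈ admissible s, value P (payoff b) ≤ value P (payoff (FreeSemigroup.of a))

namespace LiquidityPool

variable {S A : Type*} (pool : LiquidityPool S A)

/-- `s` is a no-arbitrage state relative to the price `P`. -/
def IsNoArb (P : ℝ) (s : S) : Prop :=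
  ∀ a ∈ pool.admissible s, value P (pool.payoff a) ≤ 0

/-- For every external price there is a unique no-arbitrage state. -/
def Frictionless : Prop := ∀ P : ℝ, 0 < P → ∃! s, pool.IsNoArb P s

/-- A trade is non-null if it is not merely a repetition of the null action. -/
def NonNull (a : FreeSemigroup A) : Prop := ∃ b ∈ a.head :: a.tail, b ≠ pool.null

/-- `astar s P` is an atomic action that is admissible in `s` and maximizes the value at price
`P` among all actions admissible in `s`. -/
def IsOptimalSelection (astar : S → ℝ → A) : Prop :=
  ∀ s (P : ℝ), 0 < P → FreeSemigroup.of (astar s P) ∈ pool.admissible s ∧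
    ∀ b ∈ pool.admissible s,
      value P (pool.payoff b) ≤ value P (pool.payoff (FreeSemigroup.of (astar s P)))

open Classical in
/-- The trades executed out of a list of (labelled) trades when starting in state `s`: go through
the list and drop every trade that is not admissible in the state that the preceding executed
trades have led to. -/
def execute : S → List (ℕ × FreeSemigroup A) → List (ℕ × FreeSemigroup A)
  | _, [] => []
  | s, e :: l =>
      if e.2 ∈ pool.admissible s then e :: execute (pool.transition s e.2) l else execute s l

/-- The state reached from `s` by a list of (labelled) trades. -/
def stateAfter (s : S) (l : List (ℕ × FreeSemigroup A)) : S :=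
  l.foldl (fun s e => pool.transition s e.2) s

end LiquidityPool

/-! ## Semimartingales and stochastic integrals -/

section Stochastic

variable {Ω : Type*} {mΩ : MeasurableSpace Ω}

/-- Right-continuous with left limits. -/
def IsCadlag (f : ℝ≥0 → ℝ) : Prop :=
  ∀ t, ContinuousWithinAt f (Set.Ici t) t ∧ ∃ l, Tendsto f (𝓝[<] t) (𝓝 l)

/-- `X` is the sum of a càdlàg local martingale and of a càdlàg adapted process whose paths have
finite variation on compact intervals. -/
def IsSemimartingale (ℱ : Filtration ℝ≥0 mΩ) (μ : Measure Ω) (X : ℝ≥0 → Ω → ℝ) : Prop :=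
  ∃ M V : ℝ≥0 → Ω → ℝ,
    (StronglyAdapted ℱ M ∧ (∀ ω, IsCadlag fun t => M t ω) ∧
      Locally (fun N => Martingale N ℱ μ) ℱ M μ) ∧
    (StronglyAdapted ℱ V ∧ (∀ ω, IsCadlag fun t => V t ω) ∧
      ∀ ω, LocallyBoundedVariationOn (fun t => V t ω) Set.univ) ∧
    ∀ t ω, X t ω = M t ω + V t ω

/-- Bounded predictable processes. -/
def IsBoundedPredictable (ℱ : Filtration ℝ≥0 mΩ) (H : ℝ≥0 → Ω → ℝ) : Prop :=
  IsStronglyPredictable ℱ H ∧ ∃ C : ℝ, ∀ s ω, |H s ω| ≤ C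

/-- `J` is a stochastic integral `H ↦ ∫ H dX` over `(0, t]` for bounded predictable integrands: it
has the prescribed values on the indicators of the predictable rectangles, is linear, and obeys
the bounded convergence theorem (in probability). If `X` is a semimartingale, then there is exactly
one such `J`, up to almost sure equality. -/
structure IsBoundedIntegral (ℱ : Filtration ℝ≥0 mΩ) (μ : Measure Ω) (X : ℝ≥0 → Ω → ℝ) (t : ℝ≥0)
    (J : (ℝ≥0 → Ω → ℝ) → Ω → ℝ) : Prop where
  aestronglyMeasurable : ∀ H, IsBoundedPredictable ℱ H → AEStronglyMeasurable (J H) μ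
  initial : ∀ B : Set Ω, MeasurableSet[ℱ 0] B →
    J (fun s ω => (({0} : Set ℝ≥0) ×ˢ B).indicator (fun _ => (1 : ℝ)) (s, ω)) =ᵐ[μ] 0
  interval : ∀ u v : ℝ≥0, u ≤ v → ∀ B : Set Ω, MeasurableSet[ℱ u] B →
    J (fun s ω => (Set.Ioc u v ×ˢ B).indicator (fun _ => (1 : ℝ)) (s, ω)) =ᵐ[μ]
      B.indicator (fun ω => X (min v t) ω - X (min u t) ω)
  linear : ∀ (a b : ℝ) (H G : ℝ≥0 → Ω → ℝ), IsBoundedPredictable ℱ H → IsBoundedPredictable ℱ G →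
    J (fun s ω => a * H s ω + b * G s ω) =ᵐ[μ] fun ω => a * J H ω + b * J G ω
  bounded_convergence : ∀ (H : ℕ → ℝ≥0 → Ω → ℝ) (G : ℝ≥0 → Ω → ℝ) (C : ℝ),
    (∀ n, IsStronglyPredictable ℱ (H n)) → (∀ n s ω, |H n s ω| ≤ C) →
    (∀ s ω, Tendsto (fun n => H n s ω) atTop (𝓝 (G s ω))) →
    TendstoInMeasure μ (fun n => J (H n)) atTop (J G)

/-- The predictable process `H` is integrable with respect to `X` on `(0, t]`, and `Z` is (a version
of) `∫₀ᵗ H dX`: the integral of the process `0` is `0`, and in general, for all bounded predictable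
`Hₙ → H` with `|Hₙ| ≤ |H|`, the integrals of the `Hₙ` converge to `Z` in probability. For a
semimartingale `X` the first clause is a special case of the second. -/
def IsStochasticIntegral (ℱ : Filtration ℝ≥0 mΩ) (μ : Measure Ω) (X : ℝ≥0 → Ω → ℝ) (t : ℝ≥0)
    (H : ℝ≥0 → Ω → ℝ) (Z : Ω → ℝ) : Prop :=
  IsStronglyPredictable ℱ H ∧ AEStronglyMeasurable Z μ ∧
  (((∀ s ω, H s ω = 0) ∧ Z =ᵐ[μ] 0) ∨
    ((∃ J, IsBoundedIntegral ℱ μ X t J) ∧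
      ∀ J, IsBoundedIntegral ℱ μ X t J →
        ∀ Hn : ℕ → ℝ≥0 → Ω → ℝ, (∀ n, IsBoundedPredictable ℱ (Hn n)) →
          (∀ n s ω, |Hn n s ω| ≤ |H s ω|) →
          (∀ s ω, Tendsto (fun n => Hn n s ω) atTop (𝓝 (H s ω))) →
          TendstoInMeasure μ (fun n => J (Hn n)) atTop Z))

/-- The expectation `E[X⁺] - E[X⁻]` of an extended-real random variable, as an extended real
number. If both terms are infinite, the value is `⊥`. -/
def expectation (μ : Measure Ω) (X : Ω → EReal) : EReal :=
  ((∫⁻ ω, (X ω).toENNReal ∂μ : ℝ≥0∞) : EReal) - ((∫⁻ ω, (-X ω).toENNReal ∂μ : ℝ≥0∞) : EReal)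

/-- `Z` is the essential supremum of the family `𝒳` of random variables, i.e. its supremum for the
order of almost sure inequality. -/
def IsEssSupremum (μ : Measure Ω) (𝒳 : Set (Ω → EReal)) (Z : Ω → EReal) : Prop :=
  AEMeasurable Z μ ∧ (∀ X ∈ 𝒳, X ≤ᵐ[μ] Z) ∧
    ∀ Y : Ω → EReal, AEMeasurable Y μ → (∀ X ∈ 𝒳, X ≤ᵐ[μ] Y) → Z ≤ᵐ[μ] Y

/-! ## Blockchain markets -/

/-- A blockchain market with deterministic block times: a liquidity pool, an external market price
(a positive semimartingale), block times, and an ordering mechanism. Blocks are numbered from `0`.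
`orderLaw n T` is the distribution over the permutations of the sequence `T` of trades submitted
for block `n`, and the random permutation `order n T` has this law. Nothing is assumed on its
dependence on the rest of the market. -/
structure BlockchainMarket (S A : Type*) {Ω : Type*} {mΩ : MeasurableSpace Ω} (μ : Measure Ω) where
  pool : LiquidityPool S A
  ℱ : Filtration ℝ≥0 mΩ
  price : ℝ≥0 → Ω → ℝ
  price_semimartingale : IsSemimartingale ℱ μ price
  price_pos : ∀ t ω, 0 < price t ω
  blockTime : ℕ → ℝ≥0
  blockTime_pos : ∀ n, 0 < blockTime n
  blockTime_strictMono : StrictMono blockTime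
  blockTime_tendsto : Tendsto blockTime atTop atTop
  orderLaw : ℕ → (T : List (FreeSemigroup A)) → PMF (Equiv.Perm (Fin T.length))
  order : ℕ → (T : List (FreeSemigroup A)) → Ω → Equiv.Perm (Fin T.length)
  order_measurable : ∀ n T σ, MeasurableSet {ω | order n T ω = σ}
  order_law : ∀ n T σ, μ {ω | order n T ω = σ} = orderLaw n T σ

/-- All on-chain trades submitted for each block, by all participants. A trade in the list is
identified by its position, so that several copies of an action can be submitted. -/
abbrev Submissions (Ω A : Type*) := ℕ → Ω → List (FreeSemigroup A)

/-- The data of a trading strategy: its holdings of the risky asset and of the numéraire, and, for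
each block, which of the on-chain trades submitted for the block are its own. -/
structure Strategy (Ω : Type*) where
  x : ℝ≥0 → Ω → ℝ
  y : ℝ≥0 → Ω → ℝ
  own : ℕ → Ω → Finset ℕ

/-- The sum of a finite family of strategies. -/
def Strategy.sum {k : ℕ} (𝒮 : Fin k → Strategy Ω) : Strategy Ω where
  x t ω := ∑ i, (𝒮 i).x t ω
  y t ω := ∑ i, (𝒮 i).y t ω
  own n ω := Finset.univ.biUnion fun i => (𝒮 i).own n ω

/-- An arbitrage strategy never holds the risky asset. -/
def Strategy.IsArbitrage (strat : Strategy Ω) : Prop := ∀ t ω, strat.x t ω = 0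

namespace BlockchainMarket

variable {S A : Type*} {μ : Measure Ω} (B : BlockchainMarket S A μ)

/-- The price at the time of block `n`. -/
def blockPrice (n : ℕ) (ω : Ω) : ℝ := B.price (B.blockTime n) ω

/-- The number of blocks up to time `t`. -/
def blockCount (t : ℝ≥0) : ℕ := {n | B.blockTime n ≤ t}.ncard

/-- The trades submitted for block `n`, labelled with their positions, after the random
permutation. -/
def orderedTrades (T : Submissions Ω A) (n : ℕ) (ω : Ω) : List (ℕ × FreeSemigroup A) :=
  (List.finRange (T n ω).length).map fun j =>
    ((B.order n (T n ω) ω j : ℕ), (T n ω).get (B.order n (T n ω) ω j))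

/-- The pool state at the time of block `n`, before the trades of that block. -/
def state (T : Submissions Ω A) : ℕ → Ω → S
  | 0, _ => B.pool.initialState
  | n + 1, ω => B.pool.stateAfter (state T n ω)
      (B.pool.execute (state T n ω) (B.orderedTrades T n ω))

/-- The trades executed for block `n`, labelled with their positions in the list of all
submissions. -/
def executed (T : Submissions Ω A) (n : ℕ) (ω : Ω) : List (ℕ × FreeSemigroup A) :=
  B.pool.execute (B.state T n ω) (B.orderedTrades T n ω)

/-- The value, at the price at the time of block `n`, of the payoffs of those trades executed for
block `n` that are owned by the strategy. -/
def blockGain (T : Submissions Ω A) (strat : Strategy Ω) (n : ℕ) (ω : Ω) : ℝ :=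
  (((B.executed T n ω).filter fun e => e.1 ∈ strat.own n ω).map
    fun e => value (B.blockPrice n ω) (B.pool.payoff e.2)).sum

/-- The profit and loss `x_t P_t + y_t - (x_0 P_0 + y_0)` of a strategy. -/
def pnl (strat : Strategy Ω) (t : ℝ≥0) (ω : Ω) : ℝ :=
  strat.x t ω * B.price t ω + strat.y t ω - (strat.x 0 ω * B.price 0 ω + strat.y 0 ω)

/-- The changes of wealth of the strategy are the gains from trading in the external market plus
those from its executed on-chain trades. -/
def IsSelfFinancing (T : Submissions Ω A) (strat : Strategy Ω) : Prop :=
  ∀ t, ∃ Z, IsStochasticIntegral B.ℱ μ B.price t strat.x Z ∧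
    ∀ᵐ ω ∂μ, B.pnl strat t ω =
      Z ω + ∑ n ∈ Finset.range (B.blockCount t), B.blockGain T strat n ω

/-- `strat` is a (self-financing) trading strategy when `T` is the list of all submitted trades.
The payoffs of the trades it submits for a block are known at the time of that block. -/
structure IsTradingStrategy (T : Submissions Ω A) (strat : Strategy Ω) : Prop where
  predictable : IsStronglyPredictable B.ℱ strat.x
  adapted : StronglyAdapted B.ℱ strat.y
  own_lt : ∀ n ω, ∀ j ∈ strat.own n ω, j < (T n ω).length
  own_measurable : ∀ n j, MeasurableSet[B.ℱ (B.blockTime n)] {ω | j ∈ strat.own n ω}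
  payoff_measurable : ∀ n j, Measurable[B.ℱ (B.blockTime n)] fun ω =>
    if j ∈ strat.own n ω then ((T n ω)[j]?).elim 0 B.pool.payoff else 0
  integrable : ∀ t : ℝ≥0, ∫⁻ ω, (∫⁻ s in Set.Icc (0 : ℝ) t,
    ENNReal.ofReal ((strat.x s.toNNReal ω) ^ 2 * (B.price s.toNNReal ω) ^ 2) ∂volume) ∂μ < ∞
  selfFinancing : B.IsSelfFinancing T strat

/-- The executed on-chain trades of the strategies are disjoint. -/
def Concurrent (T : Submissions Ω A) {k : ℕ} (𝒮 : Fin k → Strategy Ω) : Prop :=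
  ∀ n ω, ∀ e ∈ B.executed T n ω, ∀ i j, e.1 ∈ (𝒮 i).own n ω → e.1 ∈ (𝒮 j).own n ω → i = j

/-- Concurrent, and all on-chain trades come from the strategies. -/
def Covering (T : Submissions Ω A) {k : ℕ} (𝒮 : Fin k → Strategy Ω) : Prop :=
  B.Concurrent T 𝒮 ∧ ∀ n ω, (Strategy.sum 𝒮).own n ω = Finset.range (T n ω).length

/-- Covering, and the sum of the strategies is an arbitrage strategy. -/
def Complete (T : Submissions Ω A) {k : ℕ} (𝒮 : Fin k → Strategy Ω) : Prop :=
  B.Covering T 𝒮 ∧ (Strategy.sum 𝒮).IsArbitrage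

/-- For block `n`, the strategy submits a non-null trade that is admissible in the pool state at
the time of the block. -/
def SubmitsNonNull (T : Submissions Ω A) (strat : Strategy Ω) (n : ℕ) (ω : Ω) : Prop :=
  ∃ j ∈ strat.own n ω, ∃ a, (T n ω)[j]? = some a ∧
    a ∈ B.pool.admissible (B.state T n ω) ∧ B.pool.NonNull a

/-- A competitive set of `k` trading strategies. -/
structure Competitive (T : Submissions Ω A) {k : ℕ} (𝒮 : Fin k → Strategy Ω) : Prop where
  isTradingStrategy : ∀ i, B.IsTradingStrategy T (𝒮 i)
  complete : B.Complete T 𝒮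
  noArb : ∀ᵐ ω ∂μ, ∀ n, B.pool.IsNoArb (B.blockPrice n ω) (B.state T (n + 1) ω)
  active : k = 1 ∨ ∀ᵐ ω ∂μ,
    (∀ i, ∃ n, B.SubmitsNonNull T (𝒮 i) n ω) ∧
    {n | ∃ i j, i ≠ j ∧ B.SubmitsNonNull T (𝒮 i) n ω ∧ B.SubmitsNonNull T (𝒮 j) n ω}.Infinite

/-- The total profit and loss of a set of strategies at time `t`. -/
def totalPnl {k : ℕ} (𝒮 : Fin k → Strategy Ω) (t : ℝ≥0) (ω : Ω) : EReal :=
  ((∑ i, B.pnl (𝒮 i) t ω : ℝ) : EReal)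

/-- The family of the total profits and losses at time `t` of all competitive sets of `m` or more
strategies. -/
def competitivePnls (m : ℕ) (t : ℝ≥0) : Set (Ω → EReal) :=
  {X | ∃ (T : Submissions Ω A) (k : ℕ) (𝒮 : Fin k → Strategy Ω),
    m ≤ k ∧ B.Competitive T 𝒮 ∧ X = B.totalPnl 𝒮 t}

/-- The `m`-player competitive MEV at time `t`. -/
def competitiveMEV (m : ℕ) (t : ℝ≥0) : EReal :=
  ⨆ X ∈ B.competitivePnls m t, expectation μ X

/-- The random variable `Z` is (a version of) the `m`-player competitive pathwise MEV at time
`t`. -/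
def IsPathwiseMEV (m : ℕ) (t : ℝ≥0) (Z : Ω → EReal) : Prop :=
  IsEssSupremum μ (B.competitivePnls m t) Z

/-! ## The simple arbitrage strategy -/

/-- The pool states if, in every block, the only trade is the optimal atomic action. -/
def simpleState (astar : S → ℝ → A) : ℕ → Ω → S
  | 0, _ => B.pool.initialState
  | n + 1, ω => B.pool.transition (simpleState astar n ω)
      (FreeSemigroup.of (astar (simpleState astar n ω) (B.blockPrice n ω)))

/-- The submissions of the simple arbitrage strategy if no one else submits on-chain trades. -/
def simpleSubmissions (astar : S → ℝ → A) : Submissions Ω A := fun n ω =>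
  [FreeSemigroup.of (astar (B.simpleState astar n ω) (B.blockPrice n ω))]

/-- The submitted trade is indeed the optimal action in the actual pool state. -/
theorem state_simpleSubmissions {astar : S → ℝ → A} (h : B.pool.IsOptimalSelection astar)
    (n : ℕ) (ω : Ω) :
    B.state (B.simpleSubmissions astar) n ω = B.simpleState astar n ω := by
  induction n with
  | zero => rfl
  | succ n ih =>
    have hadm := (h (B.simpleState astar n ω) (B.blockPrice n ω) (B.price_pos _ _)).1
    have hord : B.orderedTrades (B.simpleSubmissions astar) n ω =
        [(0, FreeSemigroup.of (astar (B.simpleState astar n ω) (B.blockPrice n ω)))] := by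
      have key : ∀ σ : Equiv.Perm (Fin 1), ∀ a : FreeSemigroup A, (List.finRange 1).map
          (fun j => ((σ j : ℕ), ([a] : List (FreeSemigroup A)).get (σ j))) = [(0, a)] := by
        intro σ a
        have h0 : σ = 1 := Subsingleton.elim _ _
        subst h0
        rfl
      exact key _ _
    rw [state, ih, hord, simpleState, LiquidityPool.execute, if_pos hadm]
    rfl

/-- The simple arbitrage strategy `S₀`, left uncontested (with initial holdings `0`). Being
a self-financing arbitrage strategy, it holds no risky asset, and its holdings of the numéraire
are its accumulated gains. -/
def simpleArbitrage (astar : S → ℝ → A) : Strategy Ω where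
  x _ _ := 0
  y t ω := ∑ n ∈ Finset.range (B.blockCount t),
    B.blockGain (B.simpleSubmissions astar) ⟨fun _ _ => 0, fun _ _ => 0, fun _ _ => {0}⟩ n ω
  own _ _ := {0}

/-- `PNL*(S₀)`, the uncontested profit and loss of the simple arbitrage strategy. -/
def simplePnl (astar : S → ℝ → A) (t : ℝ≥0) (ω : Ω) : ℝ := B.pnl (B.simpleArbitrage astar) t ω

end BlockchainMarket

end Stochastic

end CompetitiveMEV

end

namespace CompetitiveMEV

/-! Up to almost sure equality, the profit of the simple arbitrage strategy is the largest element
of the family of competitive total profits, for every `m` under consideration. A largest element is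
at once the essential supremum and, by monotonicity of the expectation, the one that realizes the
supremum of expectations. Hence both identities.

Upper bound (`Competitive.totalPnl_le`). The risky holdings of a competitive set cancel, hence so do
their stochastic integrals (`sum_stochasticIntegral_eq_zero`), and only on-chain gains remain.
No-arbitrage states are unique, so almost surely the pool passes through the same states as under
simple arbitrage (`Competitive.state_eq`). Within a block, the executed trades followed by an
optimal action form one admissible trade, so they gain at most the optimal value
(`IsOptimalSelection.sum_execute_le`).

Attainment (`simplePnl_mem_competitivePnls`). For `m = 1` the simple strategy is used alone. For `m
≥ 2`, each of `m` players also submits, in every block from some block after `t` on, a non-null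
trade that returns to the current no-arbitrage state (`Frictionless.exists_isLoopSelection`). This
makes the set competitive and leaves profits up to `t` unchanged.

The delicate point is that payoffs must be known at the block time, although states carry no
measurable structure. A round trip between two no-arbitrage states has payoff zero
(`Frictionless.roundTrip`), so optimal payoffs are differences of a potential
(`Frictionless.optPayoff_add`) whose coordinates are monotone in the price, hence measurable. -/

theorem value_add (P : ℝ) (v w : ℝ × ℝ) : value P (v + w) = value P v + value P w := by
  simp only [value, Prod.fst_add, Prod.snd_add]; ring

theorem value_zero (P : ℝ) : value P 0 = 0 := by simp [value]

/-! ### Words of trades, no-arbitrage states and loops -/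

namespace LiquidityPool

variable {S A : Type*} (pool : LiquidityPool S A)

theorem payoff_eq_zero_of_not_nonNull {a : FreeSemigroup A} (h : ¬ pool.NonNull a) :
    pool.payoff a = 0 := by
  induction a using FreeSemigroup.recOnMul with
  | ih1 x =>
    have hx : x = pool.null := by
      by_contra hx
      exact h ⟨x, by simp [FreeSemigroup.of], hx⟩
    rw [hx, pool.payoff_null]
  | ih2 x y hx hy =>
    have hx0 : x = pool.null := by
      by_contra hx0
      exact h ⟨x, by simp [FreeSemigroup.of], hx0⟩
    have hy0 : ¬ pool.NonNull y := by
      rintro ⟨b, hb, hb'⟩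
      refine h ⟨b, ?_, hb'⟩
      simp only [FreeSemigroup.head_mul, FreeSemigroup.tail_mul]
      exact List.mem_cons_of_mem _ (List.mem_append_right _ hb)
    rw [pool.payoff_mul, hy hy0, hx0, pool.payoff_null, add_zero]

theorem nonNull_mul_left {a b : FreeSemigroup A} (h : pool.NonNull a) : pool.NonNull (a * b) := by
  obtain ⟨c, hc, hc'⟩ := h
  refine ⟨c, ?_, hc'⟩
  simp only [FreeSemigroup.head_mul, FreeSemigroup.tail_mul, ← List.cons_append]
  exact List.mem_append_left _ hc

theorem isNoArb_transition {s : S} {P : ℝ} {a : FreeSemigroup A} (ha : a ∈ pool.admissible s)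
    (hopt : ∀ b ∈ pool.admissible s, value P (pool.payoff b) ≤ value P (pool.payoff a)) :
    pool.IsNoArb P (pool.transition s a) := by
  intro b hb
  have := hopt _ (pool.admissible_mul s a b ha hb)
  rw [pool.payoff_mul, value_add] at this
  linarith

/-- An admissible trade of value `0` in a no-arbitrage state leads to a no-arbitrage state. -/
theorem IsNoArb.transition {s : S} {P : ℝ} {a : FreeSemigroup A} (hs : pool.IsNoArb P s)
    (ha : a ∈ pool.admissible s) (h0 : value P (pool.payoff a) = 0) :
    pool.IsNoArb P (pool.transition s a) :=
  pool.isNoArb_transition ha fun b hb => h0 ▸ hs b hb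

/-- Some trade that is admissible in `s` has payoff `v` and leads to `s'`. -/
def Reaches (s : S) (v : ℝ × ℝ) (s' : S) : Prop :=
  ∃ a ∈ pool.admissible s, pool.payoff a = v ∧ pool.transition s a = s'

variable {pool}

theorem Reaches.refl (s : S) : pool.Reaches s 0 s :=
  ⟨_, pool.null_admissible s, pool.payoff_null, pool.transition_null s⟩

theorem Reaches.trans {s s' s'' : S} {v w : ℝ × ℝ} (h : pool.Reaches s v s')
    (h' : pool.Reaches s' w s'') : pool.Reaches s (v + w) s'' := by
  obtain ⟨a, ha, rfl, rfl⟩ := h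
  obtain ⟨b, hb, rfl, rfl⟩ := h'
  exact ⟨a * b, pool.admissible_mul _ _ _ ha hb, pool.payoff_mul _ _, pool.transition_mul _ _ _⟩

theorem Reaches.nsmul {s : S} {v : ℝ × ℝ} (h : pool.Reaches s v s) (n : ℕ) :
    pool.Reaches s (n • v) s := by
  induction n with
  | zero => simpa using Reaches.refl s
  | succ n ih => rw [succ_nsmul]; exact ih.trans h

theorem value_nsmul (P : ℝ) (n : ℕ) (v : ℝ × ℝ) : value P (n • v) = n * value P v := by
  simp only [value, Prod.smul_fst, Prod.smul_snd]
  simp only [nsmul_eq_mul]; ring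

/-- The payoff of a loop is nonpositive in both assets. -/
theorem Reaches.loop_nonpos {s : S} {v : ℝ × ℝ} (h : pool.Reaches s v s) : v.1 ≤ 0 ∧ v.2 ≤ 0 := by
  have key : ∀ P : ℝ, 0 < P → v.1 * P + v.2 ≤ 0 := by
    intro P hP
    by_contra! hpos
    obtain ⟨a, -, ha⟩ := pool.exists_optimal s P hP
    obtain ⟨n, hn⟩ := exists_nat_gt
      (value P (pool.payoff (FreeSemigroup.of a)) / (v.1 * P + v.2))
    obtain ⟨b, hb, hbv, -⟩ := h.nsmul n
    have := ha b hb
    rw [hbv, value_nsmul] at this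
    rw [div_lt_iff₀ hpos] at hn
    simp only [value] at this hn
    linarith
  constructor
  · by_contra! h1
    -- At this price the risky part is worth `|v.2| + 1`, which outweighs `v.2`.
    have hP : 0 < (|v.2| + 1) / v.1 := by positivity
    have := key _ hP
    rw [mul_div_cancel₀ _ h1.ne'] at this
    linarith [neg_abs_le v.2]
  · by_contra! h2
    -- At this price the risky part is worth at most `v.2 / 2` in absolute value.
    have hP : 0 < v.2 / (2 * (|v.1| + 1)) := by positivity
    have := key _ hP
    have h3 : |v.1| * (v.2 / (2 * (|v.1| + 1))) ≤ v.2 / 2 := by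
      rw [mul_div_assoc', div_le_div_iff₀ (by positivity) (by positivity)]
      nlinarith [abs_nonneg v.1]
    have h4 := mul_le_mul_of_nonneg_right (neg_abs_le v.1) hP.le
    linarith

/-! ### Optimal payoffs as functions of the price -/

section Optimal

variable {astar : S → ℝ → A}

variable (pool) in
/-- The payoff of the selected optimal action. -/
noncomputable def optPayoff (astar : S → ℝ → A) (s : S) (P : ℝ) : ℝ × ℝ :=
  pool.payoff (FreeSemigroup.of (astar s P))

theorem IsOptimalSelection.value_nonneg (h : pool.IsOptimalSelection astar) (s : S) {P : ℝ}
    (hP : 0 < P) : 0 ≤ value P (pool.optPayoff astar s P) := by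
  have := (h s P hP).2 _ (pool.null_admissible s)
  rwa [pool.payoff_null, value_zero] at this

theorem IsOptimalSelection.isNoArb (h : pool.IsOptimalSelection astar) (s : S) {P : ℝ}
    (hP : 0 < P) : pool.IsNoArb P (pool.transition s (FreeSemigroup.of (astar s P))) :=
  pool.isNoArb_transition (h s P hP).1 (h s P hP).2

theorem Reaches.value_le (h : pool.IsOptimalSelection astar) {s s' : S} {v : ℝ × ℝ}
    (hv : pool.Reaches s v s') {P : ℝ} (hP : 0 < P) :
    value P v ≤ value P (pool.optPayoff astar s P) := by
  obtain ⟨a, ha, rfl, -⟩ := hv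
  exact (h s P hP).2 a ha

theorem Frictionless.reaches (hF : pool.Frictionless) (h : pool.IsOptimalSelection astar) (s : S)
    {s' : S} {P : ℝ} (hP : 0 < P) (hs' : pool.IsNoArb P s') :
    pool.Reaches s (pool.optPayoff astar s P) s' :=
  ⟨_, (h s P hP).1, rfl, (hF P hP).unique (h.isNoArb s hP) hs'⟩

/-- Adding the two optimality inequalities, each tested on the optimal action for the other price,
gives the usual monotonicity of maximizers of a linear functional. -/
theorem IsOptimalSelection.fst_mono (h : pool.IsOptimalSelection astar) (s : S) {P Q : ℝ}
    (hP : 0 < P) (hPQ : P ≤ Q) : (pool.optPayoff astar s P).1 ≤ (pool.optPayoff astar s Q).1 := by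
  rcases hPQ.eq_or_lt with rfl | hlt
  · exact le_rfl
  have h1 := (h s P hP).2 _ (h s Q (hP.trans hlt)).1
  have h2 := (h s Q (hP.trans hlt)).2 _ (h s P hP).1
  simp only [value] at h1 h2
  change (pool.payoff _).1 ≤ (pool.payoff _).1
  nlinarith

theorem IsOptimalSelection.snd_anti (h : pool.IsOptimalSelection astar) (s : S) {P Q : ℝ}
    (hP : 0 < P) (hPQ : P ≤ Q) : (pool.optPayoff astar s Q).2 ≤ (pool.optPayoff astar s P).2 := by
  have h0 := h.fst_mono s hP hPQ
  have h1 := (h s P hP).2 _ (h s Q (hP.trans_le hPQ)).1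
  simp only [value] at h1
  simp only [optPayoff] at h0 ⊢
  nlinarith

/-- Monotonicity is known only for positive prices; the exponential turns it into monotonicity on
the whole line. -/
theorem IsOptimalSelection.measurable_exp (h : pool.IsOptimalSelection astar) (s : S) :
    Measurable fun r : ℝ => pool.optPayoff astar s (Real.exp r) := by
  refine Measurable.prodMk (f := fun r => (pool.optPayoff astar s (Real.exp r)).1)
    (g := fun r => (pool.optPayoff astar s (Real.exp r)).2) ?_ ?_
  · exact Monotone.measurable fun a b hab =>
      h.fst_mono s (Real.exp_pos a) (Real.exp_le_exp.2 hab)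
  · exact Antitone.measurable fun a b hab =>
      h.snd_anti s (Real.exp_pos a) (Real.exp_le_exp.2 hab)

theorem IsOptimalSelection.measurable_comp (h : pool.IsOptimalSelection astar) (s : S)
    {Ω : Type*} {m : MeasurableSpace Ω} {f : Ω → ℝ} (hf : Measurable f) (hpos : ∀ ω, 0 < f ω) :
    Measurable fun ω => pool.optPayoff astar s (f ω) := by
  have := (h.measurable_exp s).comp (Real.measurable_log.comp hf)
  simpa only [Function.comp_def, Real.exp_log (hpos _)] using this

/-- If the pool is at `s` and the price moves from `q` to `r > q` and back, then the
loss is of second order. -/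
theorem roundTrip_value_ge (h : pool.IsOptimalSelection astar) {σ : ℝ → S} {q r : ℝ} (hq : 0 < q)
    (hr : 0 < r) :
    -((pool.optPayoff astar (σ q) r).1 * (r - q)) ≤
      value q (pool.optPayoff astar (σ q) r + pool.optPayoff astar (σ r) q) := by
  have h1 := h.value_nonneg (σ q) hr
  have h2 := h.value_nonneg (σ r) hq
  simp only [value, Prod.fst_add, Prod.snd_add] at h1 h2 ⊢
  linarith

/-- The round trip is a loop, so its payoff is nonpositive. Conversely, split `[p, q]` into `n`
equal steps. The round trip over one step loses at most the step length times the risky payoff of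
the upward step, so going up and down the whole grid loses `O(1/n)`. The direct trades are compared
with the grid trades by optimality and by closing mixed loops. -/
theorem roundTrip_aux (hF : pool.Frictionless) (h : pool.IsOptimalSelection astar) {σ : ℝ → S}
    (hσ : ∀ P, 0 < P → pool.IsNoArb P (σ P)) {p q : ℝ} (hp : 0 < p) (hpq : p < q) :
    pool.optPayoff astar (σ p) q + pool.optPayoff astar (σ q) p = 0 := by
  set d : ℝ → ℝ → ℝ × ℝ := fun a b => pool.optPayoff astar (σ a) b with hd
  have hq : 0 < q := hp.trans hpq
  have hreach : ∀ a b, 0 < a → 0 < b → pool.Reaches (σ a) (d a b) (σ b) :=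
    fun a b _ hb => hF.reaches h (σ a) hb (hσ b hb)
  have hz := ((hreach p q hp hq).trans (hreach q p hq hp)).loop_nonpos
  set C : ℝ := -(d q p).1 with hC
  -- `L1` and `L2` are the losses of the grid round trip in the two assets. The bound `C` on the
  -- risky payoff of the ascent does not depend on `n`: it comes from closing the ascent with the
  -- direct trade back to `p`.
  have est : ∀ n : ℕ, 0 < n → ∃ L1 L2 : ℝ, 0 ≤ L1 ∧ 0 ≤ L2 ∧ L1 * p + L2 ≤ (q - p) / n * C ∧
      -(L2 / q + L2 / p + L1) ≤ (d p q + d q p).1 ∧ -(q * L1 + p * L1 + L2) ≤ (d p q + d q p).2 := by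
    intro n hn
    have hn' : (0 : ℝ) < n := by exact_mod_cast hn
    set δ : ℝ := (q - p) / n with hδ
    have hδ0 : 0 < δ := div_pos (by linarith) hn'
    let P : ℕ → ℝ := fun i => p + i * δ
    have hP : ∀ i, 0 < P i := fun i => by positivity
    have hPp : ∀ i, p ≤ P i := fun i => by
      have : 0 ≤ (i : ℝ) * δ := by positivity
      simp only [P]; linarith
    have hP0 : P 0 = p := by simp [P]
    have hPn : P n = q := by
      simp only [P, hδ]; field_simp; ring
    have hPs : ∀ i, P (i + 1) - P i = δ := fun i => by simp only [P]; push_cast; ring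
    let u : ℕ → ℝ × ℝ := fun j => ∑ i ∈ Finset.range j, d (P i) (P (i + 1))
    let w : ℕ → ℝ × ℝ := fun j => ∑ i ∈ Finset.range j, d (P (i + 1)) (P i)
    have hu : ∀ j, pool.Reaches (σ p) (u j) (σ (P j)) := by
      intro j
      induction j with
      | zero => simpa [u, hP0] using Reaches.refl (pool := pool) (σ p)
      | succ j ih =>
        simp only [u, Finset.sum_range_succ]
        exact ih.trans (hreach _ _ (hP _) (hP _))
    have hw : ∀ j, pool.Reaches (σ (P j)) (w j) (σ p) := by
      intro j
      induction j with
      | zero => simpa [w, hP0] using Reaches.refl (pool := pool) (σ p)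
      | succ j ih =>
        simp only [w, Finset.sum_range_succ]
        rw [add_comm (∑ i ∈ Finset.range j, _)]
        exact (hreach _ _ (hP (j + 1)) (hP j)).trans ih
    have hun := hu n
    have hwn := hw n
    rw [hPn] at hun hwn
    have hL : ∀ j, (u j + w j).1 ≤ 0 ∧ (u j + w j).2 ≤ 0 ∧
        -((u j).1 * δ) ≤ (u j + w j).1 * p + (u j + w j).2 := by
      intro j
      induction j with
      | zero => simp [u, w]
      | succ j ih =>
        obtain ⟨i1, i2, i3⟩ := ih
        have e1 := ((hreach _ _ (hP j) (hP (j + 1))).trans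
          (hreach _ _ (hP (j + 1)) (hP j))).loop_nonpos
        have e2 := roundTrip_value_ge h (σ := σ) (hP j) (hP (j + 1))
        rw [hPs] at e2
        simp only [u, w, hd, value, Finset.sum_range_succ, Prod.fst_add, Prod.snd_add]
          at i1 i2 i3 e1 e2 ⊢
        -- The risky payoff of the small loop is nonpositive, so lowering the price from `P j` to
        -- `p` only raises its value.
        have := mul_nonneg_of_nonpos_of_nonpos e1.1 (sub_nonpos.2 (hPp j))
        refine ⟨by linarith [e1.1], by linarith [e1.2], by nlinarith⟩
    obtain ⟨l1, l2, l3⟩ := hL n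
    -- Mixed loops (direct one way, grid the other) bound the direct payoffs from above in each
    -- asset; optimality bounds their values from below. Together these bound each coordinate from
    -- below.
    have a0 := ((hreach p q hp hq).trans hwn).loop_nonpos
    have b0 := (hun.trans (hreach q p hq hp)).loop_nonpos
    have a1 := hun.value_le h hq
    have b1 := hwn.value_le h hp
    change value q (u n) ≤ value q (d p q) at a1
    change value p (w n) ≤ value p (d q p) at b1
    simp only [value, Prod.fst_add, Prod.snd_add] at l1 l2 l3 a0 b0 a1 b1 ⊢
    refine ⟨-((u n).1 + (w n).1), -((u n).2 + (w n).2), by linarith, by linarith, ?_, ?_, ?_⟩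
    · have : (u n).1 * δ ≤ C * δ := mul_le_mul_of_nonneg_right (by simp only [hC]; linarith) hδ0.le
      linarith
    · have ha : -(-((u n).2 + (w n).2) / q) ≤ (d p q).1 - (u n).1 := by
        rw [← neg_div, neg_neg, div_le_iff₀ hq]
        nlinarith
      have hb : -(-((u n).2 + (w n).2) / p) ≤ (d q p).1 - (w n).1 := by
        rw [← neg_div, neg_neg, div_le_iff₀ hp]
        nlinarith
      linarith
    · have ha : -(q * -((u n).1 + (w n).1)) ≤ (d p q).2 - (u n).2 := by nlinarith
      have hb : -(p * -((u n).1 + (w n).1)) ≤ (d q p).2 - (w n).2 := by nlinarith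
      linarith
  have lim : ∀ z K : ℝ, (∀ n : ℕ, 0 < n → -(K / n) ≤ z) → 0 ≤ z := by
    intro z K hK
    have h0 : Tendsto (fun n : ℕ => -(K / n)) atTop (𝓝 (-0)) :=
      (tendsto_const_div_atTop_nhds_zero_nat K).neg
    rw [neg_zero] at h0
    exact le_of_tendsto h0 ((eventually_gt_atTop 0).mono fun n hn => hK n hn)
  set K : ℝ := (q - p) * C with hK
  have bd : ∀ n : ℕ, 0 < n → ∃ L1 L2 : ℝ, 0 ≤ L1 ∧ 0 ≤ L2 ∧ L1 ≤ K / n / p ∧ L2 ≤ K / n ∧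
      -(L2 / q + L2 / p + L1) ≤ (d p q + d q p).1 ∧
      -(q * L1 + p * L1 + L2) ≤ (d p q + d q p).2 := by
    intro n hn
    obtain ⟨L1, L2, h1, h2, h3, h4, h5⟩ := est n hn
    have e : (q - p) / n * C = K / n := by rw [hK]; ring
    rw [e] at h3
    have := mul_nonneg h1 hp.le
    exact ⟨L1, L2, h1, h2, by rw [le_div_iff₀ hp]; linarith, by linarith, h4, h5⟩
  have z1 : 0 ≤ (d p q + d q p).1 := by
    refine lim _ (K / q + K / p + K / p) fun n hn => ?_
    obtain ⟨L1, L2, -, -, h3, h4, h5, -⟩ := bd n hn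
    refine le_trans ?_ h5
    have e1 : L2 / q ≤ K / n / q := by gcongr
    have e2 : L2 / p ≤ K / n / p := by gcongr
    have e : (K / q + K / p + K / p) / n = K / n / q + K / n / p + K / n / p := by ring
    rw [e]; linarith
  have z2 : 0 ≤ (d p q + d q p).2 := by
    refine lim _ (q * (K / p) + p * (K / p) + K) fun n hn => ?_
    obtain ⟨L1, L2, -, -, h3, h4, -, h5⟩ := bd n hn
    refine le_trans ?_ h5
    have e1 : q * L1 ≤ q * (K / n / p) := by gcongr
    have e2 : p * L1 ≤ p * (K / n / p) := by gcongr
    have e : (q * (K / p) + p * (K / p) + K) / n =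
      q * (K / n / p) + p * (K / n / p) + K / n := by ring
    rw [e]; linarith
  exact Prod.ext (le_antisymm hz.1 z1) (le_antisymm hz.2 z2)

theorem Frictionless.roundTrip (hF : pool.Frictionless) (h : pool.IsOptimalSelection astar)
    {σ : ℝ → S} (hσ : ∀ P, 0 < P → pool.IsNoArb P (σ P)) {p q : ℝ} (hp : 0 < p) (hq : 0 < q) :
    pool.optPayoff astar (σ p) q + pool.optPayoff astar (σ q) p = 0 := by
  rcases lt_trichotomy p q with hlt | rfl | hlt
  · exact roundTrip_aux hF h hσ hp hlt
  · have h1 := (hF.reaches h (σ p) hp (hσ p hp)).loop_nonpos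
    have h2 := h.value_nonneg (σ p) hp
    simp only [value] at h2
    have h3 : (pool.optPayoff astar (σ p) p).1 = 0 := by nlinarith
    have h4 : (pool.optPayoff astar (σ p) p).2 = 0 := by nlinarith
    ext <;> simp [h3, h4]
  · rw [add_comm]; exact roundTrip_aux hF h hσ hq hlt

/-- In a frictionless pool, the payoffs of optimal actions between no-arbitrage states are the
differences of a potential. -/
theorem Frictionless.optPayoff_add (hF : pool.Frictionless) (h : pool.IsOptimalSelection astar)
    {σ : ℝ → S} (hσ : ∀ P, 0 < P → pool.IsNoArb P (σ P)) {p q r : ℝ} (hp : 0 < p) (hq : 0 < q)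
    (hr : 0 < r) :
    pool.optPayoff astar (σ p) q + pool.optPayoff astar (σ q) r = pool.optPayoff astar (σ p) r := by
  have R : ∀ a b, 0 < b → pool.Reaches (σ a) (pool.optPayoff astar (σ a) b) (σ b) :=
    fun a b hb => hF.reaches h (σ a) hb (hσ b hb)
  -- The triangle is a loop in either orientation, so both payoffs are nonpositive; their sum
  -- consists of three round trips and is zero, so both vanish.
  have h1 := (((R p q hq).trans (R q r hr)).trans (R r p hp)).loop_nonpos
  have h2 := (((R p r hr).trans (R r q hq)).trans (R q p hp)).loop_nonpos
  have e1 := hF.roundTrip h hσ hp hq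
  have e2 := hF.roundTrip h hσ hq hr
  have e3 := hF.roundTrip h hσ hp hr
  simp only [Prod.ext_iff, Prod.fst_add, Prod.snd_add, Prod.fst_zero, Prod.snd_zero] at *
  constructor <;> linarith [h1.1, h1.2, h2.1, h2.2, e1.1, e1.2, e2.1, e2.2, e3.1, e3.2]

end Optimal

end LiquidityPool
end CompetitiveMEV

namespace CompetitiveMEV

/-! ### Stochastic integrals of processes with sum zero -/

section Integral

variable {Ω : Type*} {mΩ : MeasurableSpace Ω} {ℱ : Filtration ℝ≥0 mΩ} {μ : Measure Ω}
  {X : ℝ≥0 → Ω → ℝ} {t : ℝ≥0}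

/-- Successive extraction of subsequences, one index at a time. -/
theorem exists_seq_tendsto_ae_finset {ι : Type*} (F : Finset ι) {f : ι → ℕ → Ω → ℝ}
    {g : ι → Ω → ℝ} (h : ∀ i ∈ F, TendstoInMeasure μ (f i) atTop (g i)) :
    ∃ ns : ℕ → ℕ, StrictMono ns ∧
      ∀ i ∈ F, ∀ᵐ ω ∂μ, Tendsto (fun n => f i (ns n) ω) atTop (𝓝 (g i ω)) := by
  classical
  induction F using Finset.induction_on with
  | empty => exact ⟨id, strictMono_id, by simp⟩
  | insert a F _ ih =>
    obtain ⟨ns, hns, hF⟩ := ih fun i hi => h i (Finset.mem_insert_of_mem hi)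
    obtain ⟨ms, hms, ha⟩ := ((h a (Finset.mem_insert_self a F)).comp
      hns.tendsto_atTop).exists_seq_tendsto_ae
    refine ⟨ns ∘ ms, hns.comp hms, fun i hi => ?_⟩
    rcases Finset.mem_insert.1 hi with rfl | hi
    · exact ha
    · filter_upwards [hF i hi] with ω hω
      exact hω.comp hms.tendsto_atTop

theorem isBoundedPredictable_zero : IsBoundedPredictable ℱ fun _ _ => 0 :=
  ⟨stronglyMeasurable_const, 0, by simp⟩

theorem IsBoundedPredictable.add {H G : ℝ≥0 → Ω → ℝ} (hH : IsBoundedPredictable ℱ H)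
    (hG : IsBoundedPredictable ℱ G) : IsBoundedPredictable ℱ fun s ω => H s ω + G s ω := by
  obtain ⟨hH, C, hC⟩ := hH
  obtain ⟨hG, D, hD⟩ := hG
  exact ⟨StronglyMeasurable.add hH hG, C + D,
    fun s ω => (abs_add_le _ _).trans (add_le_add (hC s ω) (hD s ω))⟩

theorem IsBoundedPredictable.sum {ι : Type*} (F : Finset ι) {H : ι → ℝ≥0 → Ω → ℝ}
    (hH : ∀ i ∈ F, IsBoundedPredictable ℱ (H i)) :
    IsBoundedPredictable ℱ fun s ω => ∑ i ∈ F, H i s ω := by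
  classical
  induction F using Finset.induction_on with
  | empty => simpa using isBoundedPredictable_zero
  | insert a F ha ih =>
    simp only [Finset.sum_insert ha]
    exact (hH a (Finset.mem_insert_self a F)).add
      (ih fun i hi => hH i (Finset.mem_insert_of_mem hi))

theorem IsBoundedIntegral.zero {J : (ℝ≥0 → Ω → ℝ) → Ω → ℝ}
    (hJ : IsBoundedIntegral ℱ μ X t J) : J (fun _ _ => 0) =ᵐ[μ] 0 := by
  have := hJ.linear 0 0 _ _ isBoundedPredictable_zero isBoundedPredictable_zero
  simp only [zero_mul, add_zero] at this
  exact this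

theorem IsBoundedIntegral.sum {J : (ℝ≥0 → Ω → ℝ) → Ω → ℝ} (hJ : IsBoundedIntegral ℱ μ X t J)
    {ι : Type*} (F : Finset ι) {H : ι → ℝ≥0 → Ω → ℝ}
    (hH : ∀ i ∈ F, IsBoundedPredictable ℱ (H i)) :
    J (fun s ω => ∑ i ∈ F, H i s ω) =ᵐ[μ] fun ω => ∑ i ∈ F, J (H i) ω := by
  classical
  induction F using Finset.induction_on with
  | empty => exact hJ.zero
  | insert a F ha ih =>
    have hF : ∀ i ∈ F, IsBoundedPredictable ℱ (H i) :=
      fun i hi => hH i (Finset.mem_insert_of_mem hi)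
    have := hJ.linear 1 1 _ _ (hH a (Finset.mem_insert_self a F)) (IsBoundedPredictable.sum F hF)
    simp only [one_mul] at this
    simp only [Finset.sum_insert ha]
    filter_upwards [this, ih hF] with ω h1 h2
    rw [h1, h2]

/-- The stochastic integrals of finitely many processes with sum `0` have sum `0`. -/
theorem sum_stochasticIntegral_eq_zero {ι : Type*} [Fintype ι] {H : ι → ℝ≥0 → Ω → ℝ}
    {Z : ι → Ω → ℝ} (h : ∀ i, IsStochasticIntegral ℱ μ X t (H i) (Z i))
    (hsum : ∀ s ω, ∑ i, H i s ω = 0) : ∀ᵐ ω ∂μ, ∑ i, Z i ω = 0 := by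
  classical
  -- Indices outside `F` contribute nothing. Those in `F` satisfy the second clause of the
  -- definition, which supplies a bounded integral `J` and holds for every such `J`, so one `J`
  -- serves them all.
  let F : Finset ι := Finset.univ.filter fun i => ¬((∀ s ω, H i s ω = 0) ∧ Z i =ᵐ[μ] 0)
  have hnF : ∀ i, i ∉ F → (∀ s ω, H i s ω = 0) ∧ Z i =ᵐ[μ] 0 := fun i hi => by
    simpa [F] using hi
  have hFi : ∀ i ∈ F, _ := fun i hi => (h i).2.2.resolve_left (Finset.mem_filter.1 hi).2
  have hsumF : ∀ s ω, ∑ i ∈ F, H i s ω = 0 := fun s ω => by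
    rw [← hsum s ω]
    exact Finset.sum_subset (Finset.subset_univ F) fun i _ hi => (hnF i hi).1 s ω
  have hZ : ∀ᵐ ω ∂μ, ∑ i, Z i ω = ∑ i ∈ F, Z i ω := by
    have : ∀ᵐ ω ∂μ, ∀ i, i ∉ F → Z i ω = 0 := by
      rw [ae_all_iff]
      intro i
      by_cases hi : i ∈ F
      · simp [hi]
      · filter_upwards [(hnF i hi).2] with ω hω _ using hω
    filter_upwards [this] with ω hω
    exact (Finset.sum_subset (Finset.subset_univ F) fun i _ hi => hω i hi).symm
  rcases F.eq_empty_or_nonempty with hF | ⟨i₀, hi₀⟩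
  · filter_upwards [hZ] with ω hω
    rw [hω, hF, Finset.sum_empty]
  obtain ⟨J, hJ⟩ := (hFi i₀ hi₀).1
  -- All processes are truncated on the same predictable set, so the truncations still sum to zero;
  -- truncating each one separately would destroy this.
  let T : ι → ℕ → ℝ≥0 → Ω → ℝ := fun i n s ω => if ∀ j, |H j s ω| ≤ n then H i s ω else 0
  have hTle : ∀ i n s ω, |T i n s ω| ≤ |H i s ω| := fun i n s ω => by
    simp only [T]; split_ifs <;> simp
  have hTb : ∀ i n, IsBoundedPredictable ℱ (T i n) := by
    refine fun i n => ⟨?_, n, fun s ω => ?_⟩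
    · have hmeas : ∀ j, StronglyMeasurable[ℱ.predictable] (Function.uncurry (H j)) :=
        fun j => (h j).1
      have hset : MeasurableSet[ℱ.predictable]
          {z : ℝ≥0 × Ω | ∀ j, |Function.uncurry (H j) z| ≤ n} := by
        rw [Set.ofPred_forall]
        exact MeasurableSet.iInter fun j =>
          (continuous_abs.measurable.comp (hmeas j).measurable) measurableSet_Iic
      exact StronglyMeasurable.ite hset (hmeas i) stronglyMeasurable_const
    · simp only [T]
      split_ifs with hc
      · exact hc i
      · simp
  have hTlim : ∀ i s ω, Tendsto (fun n => T i n s ω) atTop (𝓝 (H i s ω)) := by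
    intro i s ω
    obtain ⟨N, hN⟩ := exists_nat_ge (∑ j, |H j s ω|)
    refine tendsto_const_nhds.congr' ?_
    filter_upwards [eventually_ge_atTop N] with n hn
    have : ∀ j, |H j s ω| ≤ n := fun j =>
      (Finset.single_le_sum (f := fun j => |H j s ω|) (fun _ _ => abs_nonneg _)
        (Finset.mem_univ j)).trans (hN.trans (by exact_mod_cast hn))
    simp only [T, if_pos this]
  have hTsum : ∀ n, (fun s ω => ∑ i ∈ F, T i n s ω) = fun _ _ => 0 := by
    intro n
    funext s ω
    simp only [T]
    split_ifs
    · exact hsumF s ω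
    · simp
  have hJ0 : ∀ᵐ ω ∂μ, ∀ n, ∑ i ∈ F, J (T i n) ω = 0 := by
    rw [ae_all_iff]
    intro n
    have h1 := hJ.sum F (H := fun i => T i n) fun i _ => hTb i n
    rw [hTsum n] at h1
    filter_upwards [h1, hJ.zero] with ω h1 h2
    rw [← h1, h2, Pi.zero_apply]
  obtain ⟨ns, -, hns⟩ := exists_seq_tendsto_ae_finset F (μ := μ) (f := fun i n => J (T i n))
    (g := Z) fun i hi => (hFi i hi).2 J hJ (T i) (hTb i) (hTle i) (hTlim i)
  filter_upwards [hZ, hJ0, (Finset.eventually_all F).2 hns] with ω h1 h2 h3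
  rw [h1]
  have := tendsto_finsetSum F fun i hi => h3 i hi
  simp only [h2] at this
  exact (tendsto_nhds_unique this tendsto_const_nhds)

end Integral

section Expectation

variable {Ω : Type*} {mΩ : MeasurableSpace Ω} {μ : Measure Ω}

theorem expectation_mono {X Y : Ω → EReal} (h : X ≤ᵐ[μ] Y) :
    expectation μ X ≤ expectation μ Y := by
  refine EReal.sub_le_sub ?_ ?_
  · exact EReal.coe_ennreal_le_coe_ennreal_iff.2
      (lintegral_mono_ae (h.mono fun ω hω => EReal.toENNReal_le_toENNReal hω))
  · exact EReal.coe_ennreal_le_coe_ennreal_iff.2 (lintegral_mono_ae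
      (h.mono fun ω hω => EReal.toENNReal_le_toENNReal (EReal.neg_le_neg_iff.2 hω)))

end Expectation

/-! ### The upper bound -/

namespace LiquidityPool

variable {S A : Type*} {pool : LiquidityPool S A} {astar : S → ℝ → A}

/-- The trades executed from a state are worth at most the optimal action. -/
theorem IsOptimalSelection.sum_execute_le (h : pool.IsOptimalSelection astar) {P : ℝ} (hP : 0 < P)
    (l : List (ℕ × FreeSemigroup A)) (s : S) :
    ((pool.execute s l).map fun e => value P (pool.payoff e.2)).sum ≤
      value P (pool.optPayoff astar s P) := by
  induction l generalizing s with
  | nil => simpa [execute] using h.value_nonneg s hP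
  | cons e l ih =>
    rw [execute]
    split_ifs with he
    · rw [List.map_cons, List.sum_cons]
      have h1 := ih (pool.transition s e.2)
      -- The executed trade followed by the optimal action of the next state is itself a competitor
      -- in `s`.
      have h2 := (h s P hP).2 _ (pool.admissible_mul _ _ _ he (h _ P hP).1)
      rw [pool.payoff_mul, value_add] at h2
      exact (add_le_add_right h1 _).trans h2
    · exact ih s

theorem execute_subset (l : List (ℕ × FreeSemigroup A)) (s : S) : pool.execute s l ⊆ l := by
  induction l generalizing s with
  | nil => simp [execute]
  | cons e l ih =>
    rw [execute]
    split_ifs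
    · exact List.cons_subset_cons _ (ih _)
    · exact List.subset_cons_of_subset _ (ih s)

end LiquidityPool

namespace BlockchainMarket

variable {S A Ω : Type*} {mΩ : MeasurableSpace Ω} {μ : Measure Ω} (B : BlockchainMarket S A μ)
  {astar : S → ℝ → A}

/-- The value of the optimal action for block `n` along the states of the simple arbitrage
strategy. -/
noncomputable def simpleGain (astar : S → ℝ → A) (n : ℕ) (ω : Ω) : ℝ :=
  value (B.blockPrice n ω)
    (B.pool.optPayoff astar (B.simpleState astar n ω) (B.blockPrice n ω))

theorem blockPrice_pos (n : ℕ) (ω : Ω) : 0 < B.blockPrice n ω := B.price_pos _ _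

/-- The blocks up to `t` form an initial segment, finite because the block times diverge, so `ncard`
really counts them. -/
theorem lt_blockCount_iff (t : ℝ≥0) (n : ℕ) : n < B.blockCount t ↔ B.blockTime n ≤ t := by
  obtain ⟨N, hN⟩ := (B.blockTime_tendsto.eventually_gt_atTop t).exists
  classical
  have hex : ∃ n, t < B.blockTime n := ⟨N, hN⟩
  have hset : {n | B.blockTime n ≤ t} = Set.Iio (Nat.find hex) := by
    ext n
    simp only [Set.mem_ofPred_eq, Set.mem_Iio]
    constructor
    · intro hn
      by_contra! hle
      exact absurd ((Nat.find_spec hex).trans_le (B.blockTime_strictMono.monotone hle)) hn.not_gt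
    · intro hn
      exact not_lt.1 (Nat.find_min hex hn)
  have hcard : B.blockCount t = Nat.find hex := by
    rw [blockCount, hset, Set.ncard_eq_toFinset_card', Set.toFinset_Iio, Nat.card_Iio]
  rw [hcard]
  exact (Set.ext_iff.1 hset n).symm

theorem blockCount_zero : B.blockCount 0 = 0 := by
  by_contra h
  have := (B.lt_blockCount_iff 0 0).1 (Nat.pos_of_ne_zero h)
  exact absurd this (B.blockTime_pos 0).not_ge

theorem isNoArb_simpleState_succ (h : B.pool.IsOptimalSelection astar) (n : ℕ) (ω : Ω) :
    B.pool.IsNoArb (B.blockPrice n ω) (B.simpleState astar (n + 1) ω) :=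
  h.isNoArb _ (B.blockPrice_pos n ω)

theorem orderedTrades_simpleSubmissions (n : ℕ) (ω : Ω) :
    B.orderedTrades (B.simpleSubmissions astar) n ω =
      [(0, FreeSemigroup.of (astar (B.simpleState astar n ω) (B.blockPrice n ω)))] := by
  have key : ∀ σ : Equiv.Perm (Fin 1), ∀ a : FreeSemigroup A, (List.finRange 1).map
      (fun j => ((σ j : ℕ), ([a] : List (FreeSemigroup A)).get (σ j))) = [(0, a)] := by
    intro σ a
    obtain rfl : σ = 1 := Subsingleton.elim _ _
    rfl
  exact key _ _

theorem simplePnl_eq (h : B.pool.IsOptimalSelection astar) (t : ℝ≥0) (ω : Ω) :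
    B.simplePnl astar t ω = ∑ n ∈ Finset.range (B.blockCount t), B.simpleGain astar n ω := by
  simp only [simplePnl, pnl, simpleArbitrage, zero_mul, zero_add, blockCount_zero,
    Finset.range_zero, Finset.sum_empty, sub_zero]
  refine Finset.sum_congr rfl fun n _ => ?_
  have hadm := (h (B.simpleState astar n ω) _ (B.blockPrice_pos n ω)).1
  simp [blockGain, executed, orderedTrades_simpleSubmissions, B.state_simpleSubmissions h,
    LiquidityPool.execute, hadm, simpleGain, LiquidityPool.optPayoff]

variable {B}

theorem mem_executed_lt {T : Submissions Ω A} {n : ℕ} {ω : Ω} {e : ℕ × FreeSemigroup A}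
    (he : e ∈ B.executed T n ω) : e.1 < (T n ω).length := by
  have := LiquidityPool.execute_subset _ _ he
  obtain ⟨j, -, rfl⟩ := List.mem_map.1 this
  exact (B.order n (T n ω) ω j).2

theorem sum_filter_owner {ι α : Type*} [Fintype ι] (p : ι → α → Prop)
    [∀ i, DecidablePred (p i)] (f : α → ℝ) (l : List α) (h : ∀ e ∈ l, ∃! i, p i e) :
    ∑ i, ((l.filter fun e => p i e).map f).sum = (l.map f).sum := by
  classical
  induction l with
  | nil => simp
  | cons e l ih =>
    rw [List.map_cons, List.sum_cons, ← ih fun e' he' => h e' (List.mem_cons_of_mem _ he')]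
    obtain ⟨i₀, hi₀, huniq⟩ := h e List.mem_cons_self
    have : ∀ i, (((e :: l).filter fun e => p i e).map f).sum =
        (if i = i₀ then f e else 0) + ((l.filter fun e => p i e).map f).sum := by
      intro i
      by_cases hi : p i e
      · obtain rfl := huniq i hi
        simp [hi]
      · have hne : i ≠ i₀ := fun h => hi (h ▸ hi₀)
        simp [hi, hne]
    rw [Finset.sum_congr rfl fun i _ => this i, Finset.sum_add_distrib]
    simp

/-- All executed trades of a covering set of strategies are accounted for exactly once. -/
theorem Covering.sum_blockGain {T : Submissions Ω A} {k : ℕ} {𝒮 : Fin k → Strategy Ω}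
    (hc : B.Covering T 𝒮) (n : ℕ) (ω : Ω) :
    ∑ i, B.blockGain T (𝒮 i) n ω =
      ((B.executed T n ω).map fun e => value (B.blockPrice n ω) (B.pool.payoff e.2)).sum := by
  refine sum_filter_owner (fun i (e : ℕ × FreeSemigroup A) => e.1 ∈ (𝒮 i).own n ω) _ _ fun e he => ?_
  have hmem : e.1 ∈ (Strategy.sum 𝒮).own n ω := by
    rw [hc.2]
    exact Finset.mem_range.2 (mem_executed_lt he)
  obtain ⟨i, -, hi⟩ := Finset.mem_biUnion.1 hmem
  exact ⟨i, hi, fun j hj => hc.1 n ω e he j i hj hi⟩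

/-- After each block both pools are in the only no-arbitrage state for the block price, whatever
trades led there. -/
theorem Competitive.state_eq (hF : B.pool.Frictionless) (h : B.pool.IsOptimalSelection astar)
    {T : Submissions Ω A} {k : ℕ} {𝒮 : Fin k → Strategy Ω} (hc : B.Competitive T 𝒮) :
    ∀ᵐ ω ∂μ, ∀ n, B.state T n ω = B.simpleState astar n ω := by
  filter_upwards [hc.noArb] with ω hω n
  cases n with
  | zero => rfl
  | succ n =>
    exact (hF _ (B.blockPrice_pos n ω)).unique (hω n) (B.isNoArb_simpleState_succ h n ω)

/-- No competitive set of strategies earns more than the simple arbitrage strategy. -/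
theorem Competitive.totalPnl_le (hF : B.pool.Frictionless) (h : B.pool.IsOptimalSelection astar)
    {T : Submissions Ω A} {k : ℕ} {𝒮 : Fin k → Strategy Ω} (hc : B.Competitive T 𝒮) (t : ℝ≥0) :
    B.totalPnl 𝒮 t ≤ᵐ[μ] fun ω => (B.simplePnl astar t ω : EReal) := by
  choose Z hZ hpnl using fun i => (hc.isTradingStrategy i).selfFinancing t
  have hZ0 := sum_stochasticIntegral_eq_zero hZ hc.complete.2
  filter_upwards [hZ0, ae_all_iff.2 hpnl, hc.state_eq hF h] with ω h0 h1 h2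
  rw [totalPnl, EReal.coe_le_coe_iff, Finset.sum_congr rfl fun i _ => h1 i,
    Finset.sum_add_distrib, h0, zero_add, Finset.sum_comm, B.simplePnl_eq h]
  -- The integrals have cancelled and the states agree, so the comparison is block by block from a
  -- common state.
  refine Finset.sum_le_sum fun n _ => ?_
  rw [hc.complete.1.sum_blockGain, executed, h2 n]
  exact h.sum_execute_le (B.blockPrice_pos n ω) _ _

end BlockchainMarket
end CompetitiveMEV

noncomputable section

namespace CompetitiveMEV

/-! ### Non-null loops at no-arbitrage states -/

namespace LiquidityPool

variable {S A : Type*} {pool : LiquidityPool S A} {astar : S → ℝ → A}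

variable (pool) in
/-- `loop` selects for every no-arbitrage state a non-null admissible trade that returns to the
state. All these trades have the payoff `c`. In any other no-arbitrage state they are not
admissible or do not change the state, and `c = 0` if there is another no-arbitrage state. -/
def IsLoopSelection (loop : S → FreeSemigroup A) (c : ℝ × ℝ) : Prop :=
  ∀ P, 0 < P → ∀ s, pool.IsNoArb P s →
    loop s ∈ pool.admissible s ∧ pool.transition s (loop s) = s ∧ pool.NonNull (loop s) ∧
    pool.payoff (loop s) = c ∧ ∀ P', 0 < P' → ∀ s', pool.IsNoArb P' s' →
      (loop s ∈ pool.admissible s' → pool.transition s' (loop s) = s') ∧ (s' = s ∨ c = 0)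

/-- If there are two no-arbitrage states, the loop goes to another one and back, with payoff zero.
If there is only one, any non-null admissible trade followed by an optimal action returns to it; the
payoff may then be nonzero, but a single trade serves everywhere. -/
theorem Frictionless.exists_isLoopSelection (hF : pool.Frictionless)
    (h : pool.IsOptimalSelection astar)
    (hex : ∃ P : ℝ, 0 < P ∧ ∃ s, pool.IsNoArb P s ∧ ∃ a ∈ pool.admissible s, pool.NonNull a) :
    ∃ loop c, pool.IsLoopSelection loop c := by
  have : Nonempty S := ⟨pool.initialState⟩
  choose! σ hσ hσu using hF
  by_cases hone : ∃ Q₁ Q₂ : ℝ, 0 < Q₁ ∧ 0 < Q₂ ∧ σ Q₁ ≠ σ Q₂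
  · obtain ⟨Q₁, Q₂, h1, h2, hne⟩ := hone
    have hQ : ∀ s, ∃ Q, 0 < Q ∧ σ Q ≠ s := fun s => by
      by_cases hs : σ Q₁ = s
      · exact ⟨Q₂, h2, fun hs' => hne (hs.trans hs'.symm)⟩
      · exact ⟨Q₁, h1, hs⟩
    have hw : ∀ s, ∃ w, ∀ P, 0 < P → pool.IsNoArb P s →
        w ∈ pool.admissible s ∧ pool.transition s w = s ∧ pool.NonNull w ∧ pool.payoff w = 0 := by
      intro s
      by_cases hs : ∃ P, 0 < P ∧ pool.IsNoArb P s
      · obtain ⟨P, hP, hs⟩ := hs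
        obtain rfl := hσu P hP s hs
        obtain ⟨Q, hQ0, hQ⟩ := hQ (σ P)
        have htrans : pool.transition (σ P) (FreeSemigroup.of (astar (σ P) Q)) = σ Q :=
          hσu Q hQ0 _ (h.isNoArb _ hQ0)
        refine ⟨FreeSemigroup.of (astar (σ P) Q) * FreeSemigroup.of (astar (σ Q) P),
          fun _ _ _ => ⟨?_, ?_, ?_, ?_⟩⟩
        · refine pool.admissible_mul _ _ _ (h _ Q hQ0).1 ?_
          rw [htrans]
          exact (h _ P hP).1
        · rw [pool.transition_mul, htrans]
          exact hσu P hP _ (h.isNoArb _ hP)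
        · refine pool.nonNull_mul_left ?_
          -- A null optimal action would have payoff zero, so `σ P` would also be a no-arbitrage
          -- state for `Q`.
          by_contra hnull
          refine hQ (hσu Q hQ0 _ fun b hb => ?_).symm
          have := (h (σ P) Q hQ0).2 b hb
          rwa [pool.payoff_eq_zero_of_not_nonNull hnull, value_zero] at this
        · rw [pool.payoff_mul]
          exact Frictionless.roundTrip (fun P hP => ⟨σ P, hσ P hP, hσu P hP⟩) h hσ hP hQ0
      · exact ⟨FreeSemigroup.of pool.null, fun P hP hs' => (hs ⟨P, hP, hs'⟩).elim⟩
    choose loop hloop using hw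
    refine ⟨loop, 0, fun P hP s hs => ?_⟩
    obtain ⟨l1, l2, l3, l4⟩ := hloop s P hP hs
    refine ⟨l1, l2, l3, l4, fun P' hP' s' hs' => ⟨fun ha => ?_, Or.inr rfl⟩⟩
    -- A trade of value zero cannot leave the unique no-arbitrage state.
    rw [hσu P' hP' s' hs']
    rw [hσu P' hP' s' hs'] at ha
    refine hσu P' hP' _ ((hσ P' hP').transition _ ha ?_)
    rw [l4, value_zero]
  · push Not at hone
    obtain ⟨P, hP, s, hs, a, ha, hnull⟩ := hex
    have hall : ∀ P', 0 < P' → ∀ s', pool.IsNoArb P' s' → s' = s := fun P' hP' s' hs' => by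
      rw [hσu P' hP' s' hs', hσu P hP s hs, hone P' P hP' hP]
    have hback : pool.transition (pool.transition s a)
        (FreeSemigroup.of (astar (pool.transition s a) P)) = s := hall P hP _ (h.isNoArb _ hP)
    refine ⟨fun _ => a * FreeSemigroup.of (astar (pool.transition s a) P),
      pool.payoff (a * FreeSemigroup.of (astar (pool.transition s a) P)), fun P' hP' s' hs' => ?_⟩
    obtain rfl := hall P' hP' s' hs'
    refine ⟨pool.admissible_mul _ _ _ ha (h _ P hP).1, ?_, pool.nonNull_mul_left hnull, rfl,
      fun P'' hP'' s'' hs'' => ?_⟩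
    · rw [pool.transition_mul, hback]
    · obtain rfl := hall P'' hP'' s'' hs''
      refine ⟨fun _ => ?_, Or.inl rfl⟩
      rw [pool.transition_mul, hback]

/-- Meant for copies ordered after the optimal action, where admissibility is unknown: each copy is
either dropped or does not move the state. -/
theorem stateAfter_execute_of_loop {s : S} {w : FreeSemigroup A}
    (hw : w ∈ pool.admissible s → pool.transition s w = s) {l : List (ℕ × FreeSemigroup A)}
    (hl : ∀ e ∈ l, e.2 = w) : pool.stateAfter s (pool.execute s l) = s := by
  induction l with
  | nil => rfl
  | cons e l ih =>
    have he := hl e List.mem_cons_self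
    have ih := ih fun e he => hl e (List.mem_cons_of_mem _ he)
    rw [execute]
    split_ifs with hadm
    · rw [he] at hadm
      rw [he, hw hadm, stateAfter, List.foldl_cons, he, hw hadm]
      exact ih
    · exact ih

theorem execute_append_of_loop {s : S} {w : FreeSemigroup A} (hadm : w ∈ pool.admissible s)
    (hw : pool.transition s w = s) {l l' : List (ℕ × FreeSemigroup A)} (hl : ∀ e ∈ l, e.2 = w) :
    pool.execute s (l ++ l') = l ++ pool.execute s l' := by
  induction l with
  | nil => rfl
  | cons e l ih =>
    have he := hl e List.mem_cons_self
    rw [List.cons_append, execute, he, if_pos hadm, hw,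
      ih fun e he => hl e (List.mem_cons_of_mem _ he), List.cons_append]

theorem stateAfter_append (s : S) (l l' : List (ℕ × FreeSemigroup A)) :
    pool.stateAfter s (l ++ l') = pool.stateAfter (pool.stateAfter s l) l' :=
  List.foldl_append

theorem stateAfter_of_loop {s : S} {w : FreeSemigroup A} (hw : pool.transition s w = s)
    {l : List (ℕ × FreeSemigroup A)} (hl : ∀ e ∈ l, e.2 = w) : pool.stateAfter s l = s := by
  induction l with
  | nil => rfl
  | cons e l ih =>
    rw [stateAfter, List.foldl_cons, hl e List.mem_cons_self, hw]
    exact ih fun e he => hl e (List.mem_cons_of_mem _ he)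

end LiquidityPool

/-! ### Adaptedness of the gains, and submissions with loops -/

namespace BlockchainMarket

variable {S A Ω : Type*} {mΩ : MeasurableSpace Ω} {μ : Measure Ω} (B : BlockchainMarket S A μ)
  {astar : S → ℝ → A}

theorem price_stronglyMeasurable (t : ℝ≥0) : StronglyMeasurable[B.ℱ t] (B.price t) := by
  obtain ⟨M, V, hM, hV, h⟩ := B.price_semimartingale
  have : B.price t = M t + V t := funext fun ω => h t ω
  rw [this]
  exact (hM.1 t).add (hV.1 t)

theorem measurable_blockPrice (n : ℕ) : Measurable[B.ℱ (B.blockTime n)] (B.blockPrice n) :=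
  (B.price_stronglyMeasurable _).measurable

/-- After the first block the state is a function of the last block price, but it cannot be asked to
be measurable. Additivity of optimal payoffs eliminates it: the payoff is a difference of two values
of the potential based at the no-arbitrage state for price `1`. -/
theorem measurable_optPayoff (hF : B.pool.Frictionless) (h : B.pool.IsOptimalSelection astar)
    (n : ℕ) : Measurable[B.ℱ (B.blockTime n)] fun ω =>
      B.pool.optPayoff astar (B.simpleState astar n ω) (B.blockPrice n ω) := by
  cases n with
  | zero =>
    exact h.measurable_comp B.pool.initialState (B.measurable_blockPrice 0) (B.blockPrice_pos 0)
  | succ n =>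
    have hF' := hF
    have : Nonempty S := ⟨B.pool.initialState⟩
    choose! σ hσ hσu using hF'
    have key : ∀ ω, B.pool.optPayoff astar (B.simpleState astar (n + 1) ω) (B.blockPrice (n + 1) ω)
        = B.pool.optPayoff astar (σ 1) (B.blockPrice (n + 1) ω) -
          B.pool.optPayoff astar (σ 1) (B.blockPrice n ω) := by
      intro ω
      rw [hσu _ (B.blockPrice_pos n ω) _ (B.isNoArb_simpleState_succ h n ω)]
      exact eq_sub_of_add_eq' (hF.optPayoff_add h hσ one_pos (B.blockPrice_pos n ω)
        (B.blockPrice_pos (n + 1) ω))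
    simp only [key]
    exact (h.measurable_comp (σ 1) (B.measurable_blockPrice (n + 1)) (B.blockPrice_pos _)).sub
      (h.measurable_comp (σ 1) ((B.measurable_blockPrice n).mono
        (B.ℱ.mono (B.blockTime_strictMono n.lt_succ_self).le) le_rfl) (B.blockPrice_pos _))

theorem measurable_value {m : MeasurableSpace Ω} {f : Ω → ℝ} {g : Ω → ℝ × ℝ} (hf : Measurable f)
    (hg : Measurable g) : Measurable fun ω => value (f ω) (g ω) :=
  ((measurable_fst.comp hg).mul hf).add (measurable_snd.comp hg)

theorem measurable_simpleGain (hF : B.pool.Frictionless) (h : B.pool.IsOptimalSelection astar)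
    (n : ℕ) : Measurable[B.ℱ (B.blockTime n)] (B.simpleGain astar n) :=
  measurable_value (B.measurable_blockPrice n) (B.measurable_optPayoff hF h n)

/-- For block `n`, the optimal action and `r n` copies of the loop are submitted. -/
def loopSubmissions (astar : S → ℝ → A) (loop : S → FreeSemigroup A) (r : ℕ → ℕ) :
    Submissions Ω A := fun n ω =>
  FreeSemigroup.of (astar (B.simpleState astar n ω) (B.blockPrice n ω)) ::
    List.replicate (r n) (loop (B.simpleState astar n ω))

/-- The gains from a loop with payoff `c` for block `n`, and from the optimal action if `i = 0`. -/
def loopGain (astar : S → ℝ → A) (c : ℝ × ℝ) (r : ℕ → ℕ) (i n : ℕ) (ω : Ω) : ℝ :=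
  (if i = 0 then B.simpleGain astar n ω else 0) +
    if i < r n then value (B.blockPrice n ω) c else 0

/-- The `i`-th strategy owns one of the loops, and the optimal action if `i = 0`. -/
def loopStrategy (astar : S → ℝ → A) (c : ℝ × ℝ) (r : ℕ → ℕ) (i : ℕ) : Strategy Ω where
  x _ _ := 0
  y t ω := ∑ n ∈ Finset.range (B.blockCount t), B.loopGain astar c r i n ω
  own n _ := (if i = 0 then {0} else ∅) ∪ if i < r n then {i + 1} else ∅

theorem orderedTrades_perm (T : Submissions Ω A) (n : ℕ) (ω : Ω) :
    (B.orderedTrades T n ω).Perm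
      ((List.finRange (T n ω).length).map fun j : Fin (T n ω).length => ((j : ℕ), (T n ω).get j)) := by
  have := (Equiv.Perm.map_finRange_perm (B.order n (T n ω) ω)).map
    fun j : Fin (T n ω).length => ((j : ℕ), (T n ω).get j)
  rw [List.map_map] at this
  exact this

/-- All that matters about the random order is that it is a permutation: label `0` occurs once, and
every other entry is a loop. -/
theorem exists_orderedTrades_eq (loop : S → FreeSemigroup A) (r : ℕ → ℕ) (n : ℕ) (ω : Ω) :
    ∃ l l', B.orderedTrades (B.loopSubmissions astar loop r) n ω =
        l ++ (0, FreeSemigroup.of (astar (B.simpleState astar n ω) (B.blockPrice n ω))) :: l' ∧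
      (∀ e ∈ l, e.1 ≠ 0 ∧ e.2 = loop (B.simpleState astar n ω) ∧ r n ≠ 0) ∧
      ∀ e ∈ l', e.1 ≠ 0 ∧ e.2 = loop (B.simpleState astar n ω) ∧ r n ≠ 0 := by
  set T := B.loopSubmissions astar loop r with hT
  have hperm := B.orderedTrades_perm T n ω
  have h0 : (0, FreeSemigroup.of (astar (B.simpleState astar n ω) (B.blockPrice n ω))) ∈
      B.orderedTrades T n ω :=
    hperm.mem_iff.2 (List.mem_map.2 ⟨⟨0, Nat.succ_pos _⟩, List.mem_finRange _, rfl⟩)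
  obtain ⟨l, l', hl⟩ := List.append_of_mem h0
  have hnd : ((B.orderedTrades T n ω).map Prod.fst).Nodup := by
    rw [(hperm.map Prod.fst).nodup_iff, List.map_map]
    exact (List.nodup_finRange _).map Fin.val_injective
  have hmem : ∀ e ∈ B.orderedTrades T n ω, e.1 ≠ 0 →
      e.2 = loop (B.simpleState astar n ω) ∧ r n ≠ 0 := by
    intro e he hne
    obtain ⟨⟨j, hj⟩, -, rfl⟩ := List.mem_map.1 (hperm.mem_iff.1 he)
    cases j with
    | zero => exact (hne rfl).elim
    | succ j =>
      simp only [hT, loopSubmissions, List.length_cons, List.length_replicate] at hj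
      refine ⟨?_, by omega⟩
      simp [hT, loopSubmissions]
  rw [hl] at hnd hmem
  simp only [List.map_append, List.map_cons] at hnd
  have hnd' := List.nodup_middle.1 hnd
  rw [List.nodup_cons, List.mem_append, not_or] at hnd'
  refine ⟨l, l', hl, fun e he => ?_, fun e he => ?_⟩
  · have hne : e.1 ≠ 0 := fun h => hnd'.1.1 (List.mem_map.2 ⟨e, he, h⟩)
    exact ⟨hne, hmem e (List.mem_append_left _ he) hne⟩
  · have hne : e.1 ≠ 0 := fun h => hnd'.1.2 (List.mem_map.2 ⟨e, he, h⟩)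
    exact ⟨hne, hmem e (List.mem_append_right _ (List.mem_cons_of_mem _ he)) hne⟩

section Loop

variable {loop : S → FreeSemigroup A} {c : ℝ × ℝ} {r : ℕ → ℕ}

variable {B}

/-- Block `0` must be free of loops because the initial state need not be a no-arbitrage state.
Nothing is required of `loop` in blocks without loops, so `r = 0` needs no loop selection at all. -/
theorem isLoop_simpleState (h : B.pool.IsOptimalSelection astar)
    (hr : ∀ n, r n ≠ 0 → n ≠ 0 ∧ B.pool.IsLoopSelection loop c) {n : ℕ} (hn : r n ≠ 0) (ω : Ω) :
    let s := B.simpleState astar n ω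
    let s' := B.simpleState astar (n + 1) ω
    loop s ∈ B.pool.admissible s ∧ B.pool.transition s (loop s) = s ∧ B.pool.NonNull (loop s) ∧
      B.pool.payoff (loop s) = c ∧
      (loop s ∈ B.pool.admissible s' → B.pool.transition s' (loop s) = s') ∧ (s' = s ∨ c = 0) := by
  obtain ⟨hn0, hL⟩ := hr n hn
  obtain ⟨k, rfl⟩ := Nat.exists_eq_succ_of_ne_zero hn0
  obtain ⟨h1, h2, h3, h4, h5⟩ := hL _ (B.blockPrice_pos k ω) _ (B.isNoArb_simpleState_succ h k ω)
  exact ⟨h1, h2, h3, h4, h5 _ (B.blockPrice_pos (k + 1) ω) _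
    (B.isNoArb_simpleState_succ h (k + 1) ω)⟩

theorem execute_loopSubmissions (h : B.pool.IsOptimalSelection astar)
    (hr : ∀ n, r n ≠ 0 → n ≠ 0 ∧ B.pool.IsLoopSelection loop c) {n : ℕ} {ω : Ω}
    {l l' : List (ℕ × FreeSemigroup A)}
    (hl : ∀ e ∈ l, e.1 ≠ 0 ∧ e.2 = loop (B.simpleState astar n ω) ∧ r n ≠ 0) :
    B.pool.execute (B.simpleState astar n ω)
      (l ++ (0, FreeSemigroup.of (astar (B.simpleState astar n ω) (B.blockPrice n ω))) :: l') =
    l ++ (0, FreeSemigroup.of (astar (B.simpleState astar n ω) (B.blockPrice n ω))) ::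
      B.pool.execute (B.simpleState astar (n + 1) ω) l' := by
  have hadm := (h (B.simpleState astar n ω) _ (B.blockPrice_pos n ω)).1
  have key : ∀ l₁, B.pool.execute (B.simpleState astar n ω) (l ++ l₁) =
      l ++ B.pool.execute (B.simpleState astar n ω) l₁ := by
    intro l₁
    cases l with
    | nil => rfl
    | cons e l =>
      obtain ⟨h1, h2, -⟩ :=
        isLoop_simpleState h hr (hl e List.mem_cons_self).2.2 ω
      exact LiquidityPool.execute_append_of_loop h1 h2 fun e he => (hl e he).2.1
  rw [key, LiquidityPool.execute, if_pos hadm, simpleState]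

theorem state_loopSubmissions (h : B.pool.IsOptimalSelection astar)
    (hr : ∀ n, r n ≠ 0 → n ≠ 0 ∧ B.pool.IsLoopSelection loop c) (n : ℕ) (ω : Ω) :
    B.state (B.loopSubmissions astar loop r) n ω = B.simpleState astar n ω := by
  induction n with
  | zero => rfl
  | succ n ih =>
    obtain ⟨l, l', hll, hl, hl'⟩ := B.exists_orderedTrades_eq (astar := astar) loop r n ω
    rw [state, ih, hll, execute_loopSubmissions h hr hl, LiquidityPool.stateAfter_append]
    have e1 : B.pool.stateAfter (B.simpleState astar n ω) l = B.simpleState astar n ω := by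
      cases l with
      | nil => rfl
      | cons e l =>
        obtain ⟨-, h2, -⟩ := isLoop_simpleState h hr (hl e List.mem_cons_self).2.2 ω
        exact LiquidityPool.stateAfter_of_loop h2 fun e he => (hl e he).2.1
    rw [e1, LiquidityPool.stateAfter, List.foldl_cons]
    change B.pool.stateAfter (B.simpleState astar (n + 1) ω) _ = _
    cases l' with
    | nil => rfl
    | cons e l' =>
      obtain ⟨-, -, -, -, h5, -⟩ := isLoop_simpleState h hr (hl' e List.mem_cons_self).2.2 ω
      exact LiquidityPool.stateAfter_execute_of_loop h5 fun e he => (hl' e he).2.1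

theorem sum_map_filter {α : Type*} (p : α → Prop) [DecidablePred p] (f : α → ℝ) (l : List α) :
    ((l.filter fun e => p e).map f).sum = (l.map fun e => if p e then f e else 0).sum := by
  induction l with
  | nil => rfl
  | cons e l ih => by_cases he : p e <;> simp [he, ih]

theorem sum_map_finRange_cons_replicate {α : Type*} (g : ℕ × α → ℝ) (a w : α) (m : ℕ) :
    ((List.finRange (a :: List.replicate m w).length).map fun j : Fin _ =>
      g ((j : ℕ), (a :: List.replicate m w).get j)).sum =
      g (0, a) + ∑ j ∈ Finset.range m, g (j + 1, w) := by
  rw [← List.ofFn_eq_map, List.sum_ofFn]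
  refine (Fin.sum_univ_succ (n := (List.replicate m w).length) _).trans ?_
  congr 1
  refine (Finset.sum_congr rfl fun j _ => ?_).trans
    ((Fin.sum_univ_eq_sum_range (fun j => g (j + 1, w)) _).trans ?_)
  · simp
  · rw [List.length_replicate]

/-- The gain does not depend on the order: either the state does not change in this block and every
trade is executed, or loops have payoff zero and it is irrelevant which of them are dropped. -/
theorem blockGain_loopStrategy (h : B.pool.IsOptimalSelection astar)
    (hr : ∀ n, r n ≠ 0 → n ≠ 0 ∧ B.pool.IsLoopSelection loop c) (i n : ℕ) (ω : Ω) :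
    B.blockGain (B.loopSubmissions astar loop r) (B.loopStrategy astar c r i) n ω =
      B.loopGain astar c r i n ω := by
  set a := FreeSemigroup.of (astar (B.simpleState astar n ω) (B.blockPrice n ω)) with ha
  set P := B.blockPrice n ω with hP
  set O := (B.loopStrategy astar c r i).own n ω with hO
  have hO0 : 0 ∈ O ↔ i = 0 := by
    simp only [hO, loopStrategy, Finset.mem_union]
    split_ifs <;> simp_all
  have hOs : ∀ j, j + 1 ∈ O ↔ i < r n ∧ j = i := by
    intro j
    simp only [hO, loopStrategy, Finset.mem_union]
    split_ifs <;> simp_all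
  let g : ℕ × FreeSemigroup A → ℝ := fun e => if e.1 ∈ O then value P (B.pool.payoff e.2) else 0
  have hg0 : g (0, a) = if i = 0 then B.simpleGain astar n ω else 0 := by
    simp only [g, hO0]; rfl
  have hgain : B.blockGain (B.loopSubmissions astar loop r) (B.loopStrategy astar c r i) n ω =
      ((B.executed (B.loopSubmissions astar loop r) n ω).map g).sum :=
    sum_map_filter (fun e : ℕ × FreeSemigroup A => e.1 ∈ O) _ _
  obtain ⟨l, l', hll, hl, hl'⟩ := B.exists_orderedTrades_eq (astar := astar) loop r n ω
  rw [hgain, executed, state_loopSubmissions h hr, loopGain]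
  by_cases hn : r n = 0
  · have e1 : l = [] := List.eq_nil_iff_forall_not_mem.2 fun e he => (hl e he).2.2 hn
    have e2 : l' = [] := List.eq_nil_iff_forall_not_mem.2 fun e he => (hl' e he).2.2 hn
    rw [hll, execute_loopSubmissions h hr hl, e1, e2, hn]
    simp [LiquidityPool.execute, ← ha, ← hP, hg0]
  obtain ⟨w1, w2, -, w4, -, w6⟩ := isLoop_simpleState h hr hn ω
  rcases w6 with hs | hc
  · have hall : B.pool.execute (B.simpleState astar n ω)
        (B.orderedTrades (B.loopSubmissions astar loop r) n ω) =
        B.orderedTrades (B.loopSubmissions astar loop r) n ω := by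
      rw [hll, execute_loopSubmissions h hr hl, hs]
      have := LiquidityPool.execute_append_of_loop w1 w2 (l' := []) fun e he => (hl' e he).2.1
      simp only [List.append_nil, LiquidityPool.execute] at this
      rw [this]
    rw [hall, ((B.orderedTrades_perm _ n ω).map g).sum_eq, List.map_map]
    refine (sum_map_finRange_cons_replicate g a _ (r n)).trans ?_
    rw [hg0]
    congr 1
    simp only [g, hOs, w4]
    by_cases hi : i < r n
    · simp [hi, hP]
    · simp [hi]
  · have hzero : ∀ L : List (ℕ × FreeSemigroup A),
        (∀ e ∈ L, e.2 = loop (B.simpleState astar n ω)) → (L.map g).sum = 0 := by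
      intro L hL
      refine List.sum_eq_zero fun x hx => ?_
      obtain ⟨e, he, rfl⟩ := List.mem_map.1 hx
      simp only [g, hL e he, w4, hc, value_zero, ite_self]
    rw [hll, execute_loopSubmissions h hr hl, List.map_append, List.sum_append, List.map_cons,
      List.sum_cons, hzero l fun e he => (hl e he).2.1,
      hzero _ fun e he => (hl' e (LiquidityPool.execute_subset _ _ he)).2.1]
    simp [hc, value_zero, ← ha, ← hP, hg0]

end Loop

end BlockchainMarket
end CompetitiveMEV

end

noncomputable section

/-! ### Attainment of the bound -/

namespace CompetitiveMEV
namespace BlockchainMarket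

variable {S A Ω : Type*} {mΩ : MeasurableSpace Ω} {μ : Measure Ω} {B : BlockchainMarket S A μ}
  {astar : S → ℝ → A} {loop : S → FreeSemigroup A} {c : ℝ × ℝ} {r : ℕ → ℕ}

theorem pnl_loopStrategy (i : ℕ) (t : ℝ≥0) (ω : Ω) :
    B.pnl (B.loopStrategy astar c r i) t ω =
      ∑ n ∈ Finset.range (B.blockCount t), B.loopGain astar c r i n ω := by
  simp [pnl, loopStrategy, blockCount_zero]

theorem mem_own_loopStrategy {i n : ℕ} {ω : Ω} {j : ℕ} :
    j ∈ (B.loopStrategy astar c r i).own n ω ↔ (i = 0 ∧ j = 0) ∨ (i < r n ∧ j = i + 1) := by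
  simp only [loopStrategy, Finset.mem_union]
  split_ifs <;> simp_all

theorem measurable_loopGain (hF : B.pool.Frictionless) (h : B.pool.IsOptimalSelection astar)
    (i n : ℕ) : Measurable[B.ℱ (B.blockTime n)] (B.loopGain astar c r i n) := by
  refine Measurable.add (f := fun ω => if i = 0 then B.simpleGain astar n ω else 0)
    (g := fun ω => if i < r n then value (B.blockPrice n ω) c else 0) ?_ ?_
  · split_ifs
    · exact B.measurable_simpleGain hF h n
    · exact measurable_const
  · split_ifs
    · exact measurable_value (B.measurable_blockPrice n) measurable_const
    · exact measurable_const

theorem isTradingStrategy_loopStrategy (hF : B.pool.Frictionless)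
    (h : B.pool.IsOptimalSelection astar)
    (hr : ∀ n, r n ≠ 0 → n ≠ 0 ∧ B.pool.IsLoopSelection loop c) (i : ℕ) :
    B.IsTradingStrategy (B.loopSubmissions astar loop r) (B.loopStrategy astar c r i) where
  predictable := stronglyMeasurable_const
  adapted t := by
    have : Measurable[B.ℱ t] fun ω =>
        ∑ n ∈ Finset.range (B.blockCount t), B.loopGain astar c r i n ω :=
      Finset.measurable_fun_sum _ fun n hn => (measurable_loopGain hF h i n).mono
        (B.ℱ.mono ((B.lt_blockCount_iff t n).1 (Finset.mem_range.1 hn))) le_rfl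
    exact this.stronglyMeasurable
  own_lt n ω j hj := by
    simp only [loopSubmissions, List.length_cons, List.length_replicate]
    rcases mem_own_loopStrategy.1 hj with ⟨-, rfl⟩ | ⟨hi, rfl⟩ <;> omega
  own_measurable n j := by
    simp only [mem_own_loopStrategy]
    exact MeasurableSet.const _
  payoff_measurable n j := by
    simp only [mem_own_loopStrategy]
    split_ifs with hj
    · rcases hj with ⟨-, rfl⟩ | ⟨hi, rfl⟩
      · exact B.measurable_optPayoff hF h n
      · have : ∀ ω, ((B.loopSubmissions astar loop r n ω)[i + 1]?).elim 0 B.pool.payoff = c := by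
          intro ω
          have hn : r n ≠ 0 := by omega
          obtain ⟨-, -, -, w4, -⟩ := isLoop_simpleState h hr hn ω
          simp [loopSubmissions, hi, w4]
        simp only [this]
        exact measurable_const
    · exact measurable_const
  integrable t := by simp [loopStrategy]
  selfFinancing t := by
    -- The zero integrand is covered by the first clause of the definition, so no bounded integral
    -- has to be constructed.
    refine ⟨0, ⟨stronglyMeasurable_const, aestronglyMeasurable_const,
      Or.inl ⟨fun _ _ => rfl, EventuallyEq.rfl⟩⟩, Eventually.of_forall fun ω => ?_⟩
    rw [pnl_loopStrategy, Pi.zero_apply, zero_add]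
    exact Finset.sum_congr rfl fun n _ => (blockGain_loopStrategy h hr i n ω).symm

theorem complete_loopStrategy {k : ℕ} (hk : 0 < k) (hrk : ∀ n, r n ≤ k) :
    B.Complete (B.loopSubmissions astar loop r)
      (fun i : Fin k => B.loopStrategy astar c r i) := by
  refine ⟨⟨fun n ω e _ i j hi hj => ?_, fun n ω => ?_⟩, fun t ω => ?_⟩
  · refine Fin.ext ?_
    rcases mem_own_loopStrategy.1 hi with hi | hi <;>
      rcases mem_own_loopStrategy.1 hj with hj | hj <;> omega
  · ext j
    simp only [Strategy.sum, Finset.mem_biUnion, Finset.mem_univ, true_and, mem_own_loopStrategy,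
      loopSubmissions, List.length_cons, List.length_replicate, Finset.mem_range]
    constructor
    · rintro ⟨i, hi | hi⟩ <;> omega
    · intro hj
      cases j with
      | zero => exact ⟨⟨0, hk⟩, Or.inl ⟨rfl, rfl⟩⟩
      | succ j =>
        have := hrk n
        exact ⟨⟨j, by omega⟩, Or.inr ⟨by simpa using hj, rfl⟩⟩
  · simp [Strategy.sum, loopStrategy]

theorem submitsNonNull_loopStrategy (h : B.pool.IsOptimalSelection astar)
    (hr : ∀ n, r n ≠ 0 → n ≠ 0 ∧ B.pool.IsLoopSelection loop c) {i n : ℕ} (hi : i < r n) (ω : Ω) :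
    B.SubmitsNonNull (B.loopSubmissions astar loop r) (B.loopStrategy astar c r i) n ω := by
  have hn : r n ≠ 0 := by omega
  obtain ⟨w1, -, w3, -⟩ := isLoop_simpleState h hr hn ω
  refine ⟨i + 1, mem_own_loopStrategy.2 (Or.inr ⟨hi, rfl⟩), _, ?_, ?_, w3⟩
  · simp [loopSubmissions, hi]
  · rwa [state_loopSubmissions h hr]

theorem competitive_loopStrategy (hF : B.pool.Frictionless) (h : B.pool.IsOptimalSelection astar)
    (hr : ∀ n, r n ≠ 0 → n ≠ 0 ∧ B.pool.IsLoopSelection loop c) {k : ℕ} (hk : 0 < k)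
    (hrk : ∀ n, r n ≤ k) (hactive : k = 1 ∨ 2 ≤ k ∧ ∀ᶠ n in atTop, r n = k) :
    B.Competitive (B.loopSubmissions astar loop r)
      (fun i : Fin k => B.loopStrategy astar c r i) where
  isTradingStrategy i := isTradingStrategy_loopStrategy hF h hr i
  complete := complete_loopStrategy hk hrk
  noArb := Eventually.of_forall fun ω n => by
    rw [state_loopSubmissions h hr]
    exact B.isNoArb_simpleState_succ h n ω
  active := by
    refine hactive.imp_right fun ⟨hk2, hev⟩ => Eventually.of_forall fun ω => ⟨fun i => ?_, ?_⟩
    · obtain ⟨n, hn⟩ := hev.exists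
      exact ⟨n, submitsNonNull_loopStrategy h hr (by omega) ω⟩
    · refine Nat.frequently_atTop_iff_infinite.1 (hev.mono fun n hn => ?_).frequently
      exact ⟨⟨0, by omega⟩, ⟨1, by omega⟩, by simp,
        submitsNonNull_loopStrategy h hr (by simp; omega) ω,
        submitsNonNull_loopStrategy h hr (by simp; omega) ω⟩

theorem totalPnl_loopStrategy (h : B.pool.IsOptimalSelection astar) {k : ℕ} (hk : 0 < k)
    {t : ℝ≥0} (ht : ∀ n < B.blockCount t, r n = 0) :
    B.totalPnl (fun i : Fin k => B.loopStrategy astar c r i) t =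
      fun ω => (B.simplePnl astar t ω : EReal) := by
  funext ω
  simp only [totalPnl, pnl_loopStrategy]
  rw [Finset.sum_comm, B.simplePnl_eq h]
  congr 1
  refine Finset.sum_congr rfl fun n hn => ?_
  obtain ⟨k, rfl⟩ := Nat.exists_eq_succ_of_ne_zero hk.ne'
  simp [loopGain, ht n (Finset.mem_range.1 hn)]

/-- The profit of the simple arbitrage strategy is attained by competitive sets of strategies. -/
theorem simplePnl_mem_competitivePnls (hF : B.pool.Frictionless)
    (h : B.pool.IsOptimalSelection astar) (t : ℝ≥0) {m : ℕ} (hm : 1 ≤ m)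
    (hex : m = 1 ∨ ∃ P : ℝ, 0 < P ∧ ∃ s, B.pool.IsNoArb P s ∧
      ∃ a ∈ B.pool.admissible s, B.pool.NonNull a) :
    (fun ω => (B.simplePnl astar t ω : EReal)) ∈ B.competitivePnls m t := by
  rcases hm.eq_or_lt with rfl | hm2
  · refine ⟨B.loopSubmissions astar (fun _ => FreeSemigroup.of B.pool.null) 0, 1, _, le_rfl,
      competitive_loopStrategy (c := 0) hF h (fun n hn => (hn rfl).elim) one_pos
        (fun _ => zero_le_one) (Or.inl rfl),
      (totalPnl_loopStrategy h one_pos fun _ _ => rfl).symm⟩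
  · obtain ⟨loop, c, hloop⟩ := hF.exists_isLoopSelection h (hex.resolve_left hm2.ne')
    -- Loops may be costly, so they start only after time `t`; the maximum with `1` spares block
    -- `0`.
    set r : ℕ → ℕ := fun n => if max (B.blockCount t) 1 ≤ n then m else 0 with hr
    refine ⟨B.loopSubmissions astar loop r, m, _, le_rfl,
      competitive_loopStrategy (c := c) hF h (fun n hn => ⟨?_, hloop⟩) hm ?_ (Or.inr ⟨hm2, ?_⟩),
      (totalPnl_loopStrategy h hm ?_).symm⟩
    · rintro rfl
      simp [hr] at hn
    · intro n
      simp only [hr]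
      split_ifs <;> omega
    · filter_upwards [eventually_ge_atTop (max (B.blockCount t) 1)] with n hn
      exact if_pos hn
    · intro n hn
      exact if_neg fun h => absurd (le_of_max_le_left h) hn.not_ge

theorem aemeasurable_simplePnl (hF : B.pool.Frictionless) (h : B.pool.IsOptimalSelection astar)
    (t : ℝ≥0) : AEMeasurable (fun ω => (B.simplePnl astar t ω : EReal)) μ := by
  simp only [B.simplePnl_eq h]
  exact (measurable_coe_real_ereal.comp (Finset.measurable_fun_sum _ fun n _ =>
    (B.measurable_simpleGain hF h n).mono (B.ℱ.le _) le_rfl)).aemeasurable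

end BlockchainMarket
end CompetitiveMEV

end

theorem mainTheorem2 {S A Ω : Type*} {mΩ : MeasurableSpace Ω} (μ : Measure Ω)
    [IsProbabilityMeasure μ] (B : CompetitiveMEV.BlockchainMarket S A μ)
    (hB : B.pool.Frictionless)
    (astar : S → ℝ → A) (hastar : B.pool.IsOptimalSelection astar) :
    ∃ pathMEV : ℝ≥0 → Ω → EReal, ∀ t : ℝ≥0,
      (∀ m : ℕ, 1 ≤ m →
        (m = 1 ∨ ∃ P : ℝ, 0 < P ∧ ∃ s, B.pool.IsNoArb P s ∧
          ∃ a ∈ B.pool.admissible s, B.pool.NonNull a) →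
        B.IsPathwiseMEV m t (pathMEV t) ∧
        B.competitiveMEV m t =
          CompetitiveMEV.expectation μ (fun ω => (B.simplePnl astar t ω : EReal))) ∧
      CompetitiveMEV.expectation μ (fun ω => (B.simplePnl astar t ω : EReal)) =
        CompetitiveMEV.expectation μ (pathMEV t) := by
  -- The simple profit itself is the version of the pathwise MEV, for every `m` at once.
  refine ⟨fun t ω => (B.simplePnl astar t ω : EReal), fun t => ⟨fun m hm hex => ?_, rfl⟩⟩
  have hmem := CompetitiveMEV.BlockchainMarket.simplePnl_mem_competitivePnls hB hastar t hm hex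
  have hle : ∀ X ∈ B.competitivePnls m t, X ≤ᵐ[μ] fun ω => (B.simplePnl astar t ω : EReal) := by
    rintro X ⟨T, k, 𝒮, -, hc, rfl⟩
    exact hc.totalPnl_le hB hastar t
  refine ⟨⟨CompetitiveMEV.BlockchainMarket.aemeasurable_simplePnl hB hastar t, hle,
    fun Y _ hY => hY _ hmem⟩, le_antisymm ?_ ?_⟩
  · exact iSup₂_le fun X hX => CompetitiveMEV.expectation_mono (hle X hX)
  · exact le_iSup₂ (f := fun X _ => CompetitiveMEV.expectation μ X) _ hmem
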